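/- Let $a>0$, let $q_1:[-a,a]\to\mathbb{C}$ be continuous, and let $f\in C^2[-a,a]$ be a complex-valued solution of $A_1f:=f''-q_1f=0$ with $f(x)\neq0$ for all $x\in[-a,a]$, $f(0)=1$ and $f'(0)=h\in\mathbb{C}$. Let $q_2:=2\left(f'/f\right)^2-q_1$ be the Darboux-transformed potential. For a continuous potential $q$ on $[-a,a]$ let $H$ be the unique $C^1$ solution, on the closed diamond $|u|+|v|\le a$, of the Goursat problem $$\frac{\partial^2H(u,v)}{\partial u\,\partial v}=q(u+v)H(u,v),\qquad H(u,0)=\frac12\int_0^uq(s)\,ds,\qquad H(0,v)=0,$$ put $K(x,t)=H\left(\frac{x+t}2,\frac{x-t}2\right)$ and, for $\eta\in\mathbb{C}$ and $|x|,|t|\le a$, $$\mathbf K(x,t;\eta)=\frac \eta2+K(x,t)+\frac \eta2\int_t^x\bigl(K(x,s)-K(x,-s)\bigr)\,ds ,\qquad \mathbf T_{\eta}u(x)=u(x)+\int_{-x}^{x}\mathbf K(x,t;\eta)\,u(t)\,dt .$$ Denote these objects for $q=q_j$ by $\mathbf K_j(x,t;\eta)$ and $\mathbf T_{j;\eta}$,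 $j=1,2$ (derivatives at end points are one-sided). Define, for $u\in C^1[-a,a]$, $$T_2[u](x)=\frac1{f(x)}\left(\int_0^xf(s)\,\mathbf T_{1;h}[u'](s)\,ds+u(0)\right),\qquad x\in[-a,a].$$ Then $\mathbf K_1(\cdot,\cdot;h)$ and $\mathbf K_2(\cdot,\cdot;-h)$ are continuously differentiable on $[-a,a]^2$, and $$\mathbf K_2(x,t;-h)=-\frac1{f(x)}\left(\int_{-t}^{x}\partial_t\mathbf K_1(s,t;h)\,f(s)\,ds+\frac h2f(-t)\right)\qquad\text{for all }x,t\in[-a,a].$$ Moreover, for every $u\in C^1[-a,a]$ (in particular for every solution of $u''+\omega^2u=0$, $\omega\in\mathbb{C}$), $T_2$ admits the Volterra representation $$T_2[u](x)=u(x)+\int_{-x}^{x}\mathbf K_2(x,t;-h)\,u(t)\,dt=\mathbf T_{2;-h}[u](x),\qquad x\in[-a,a],$$ where $\mathbf K_2(x,t;-h)$ may be replaced by the right-hand side of the kernel formula; and the Volterra operator with the kernel given by that formula coincides with $\mathbf T_{2;-h}$ on $C[-a,a]$. -/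

import Mathlib

open scoped BoundedContinuousFunction

/-- The closed diamond `|u| + |v| ≤ a`, the domain of the Goursat problem in the characteristic
variables `u = (x + t) / 2`, `v = (x - t) / 2`; it corresponds to the square `|x|, |t| ≤ a`. -/
def closedDiamond (a : ℝ) : Set (ℝ × ℝ) := {p | |p.1| + |p.2| ≤ a}

/-- `H` is a (classical) solution of the Goursat problem `∂²H/∂u∂v = q (u + v) H`,
`H (u, 0) = (1/2) ∫_0^u q`, `H (0, v) = 0` on the closed diamond `|u| + |v| ≤ a`. -/
structure IsGoursatSolution (a : ℝ) (q : ℝ → ℂ) (H : ℝ → ℝ → ℂ) : Prop where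
  contDiffOn : ContDiffOn ℝ 1 (fun p : ℝ × ℝ => H p.1 p.2) (closedDiamond a)
  equation : ∀ u v : ℝ, |u| + |v| < a →
    HasDerivAt (fun v' : ℝ => deriv (fun u' : ℝ => H u' v') u) (q (u + v) * H u v) v
  boundary_u : ∀ u : ℝ, |u| ≤ a → H u 0 = (1 / 2) * ∫ s in (0 : ℝ)..u, q s
  boundary_v : ∀ v : ℝ, |v| ≤ a → H 0 v = 0

theorem abs_integral_exp_abs_le {c : ℝ} (hc : 0 < c) (u : ℝ) :
    |∫ s in (0 : ℝ)..u, Real.exp (c * |s|)| ≤ Real.exp (c * |u|) / c := by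
  have key : ∀ w : ℝ, 0 ≤ w → |∫ s in (0 : ℝ)..w, Real.exp (c * |s|)| ≤ Real.exp (c * |w|) / c := by
    intro w hw
    have h1 : ∫ s in (0 : ℝ)..w, Real.exp (c * |s|) = (Real.exp (c * w) - 1) / c := by
      rw [intervalIntegral.integral_congr (g := fun s => Real.exp (c * s))]
      · rw [intervalIntegral.integral_comp_mul_left (fun s => Real.exp s) hc.ne']
        simp [integral_exp, div_eq_inv_mul]
      · intro s hs
        rw [Set.uIcc_of_le hw] at hs
        simp [abs_of_nonneg hs.1]
    rw [h1, abs_of_nonneg hw, abs_of_nonneg]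
    · gcongr
      linarith
    · have : 1 ≤ Real.exp (c * w) := Real.one_le_exp (by positivity)
      apply div_nonneg <;> linarith
  rcases le_total 0 u with hu | hu
  · exact key u hu
  · have h2 := key (-u) (by linarith)
    have h3 : ∫ s in (0 : ℝ)..(-u), Real.exp (c * |s|) = - ∫ s in (0 : ℝ)..u, Real.exp (c * |s|) := by
      have := intervalIntegral.integral_comp_neg (a := 0) (b := u) (fun s => Real.exp (c * |s|))
      simp only [abs_neg, neg_zero] at this
      rw [this, intervalIntegral.integral_symm]
    rwa [h3, abs_neg, abs_neg] at h2

theorem norm_double_integral_le {c C : ℝ} (hc : 0 < c) (hC : 0 ≤ C) {F : ℝ → ℝ → ℂ} {u v : ℝ}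
    (hF : ∀ α ∈ Set.uIoc 0 u, ∀ β ∈ Set.uIoc 0 v,
      ‖F α β‖ ≤ C * (Real.exp (c * |α|) * Real.exp (c * |β|))) :
    ‖∫ α in (0 : ℝ)..u, ∫ β in (0 : ℝ)..v, F α β‖
      ≤ C / c ^ 2 * (Real.exp (c * |u|) * Real.exp (c * |v|)) := by
  have hcont : Continuous fun s : ℝ => Real.exp (c * |s|) := by fun_prop
  have inner : ∀ α ∈ Set.uIoc 0 u, ‖∫ β in (0 : ℝ)..v, F α β‖
      ≤ (C * (Real.exp (c * |v|) / c)) * Real.exp (c * |α|) := by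
    intro α hα
    have h1 := intervalIntegral.norm_integral_le_abs_of_norm_le (μ := MeasureTheory.volume)
      (f := fun β => F α β) (a := 0) (b := v)
      (g := fun β => (C * Real.exp (c * |α|)) * Real.exp (c * |β|))
      (by
        filter_upwards [MeasureTheory.ae_restrict_mem measurableSet_uIoc] with β hβ
        have := hF α hα β hβ
        simpa only [mul_assoc] using this)
      ((continuous_const.mul hcont).intervalIntegrable _ _)
    refine h1.trans ?_
    rw [intervalIntegral.integral_const_mul, abs_mul, abs_of_nonneg (by positivity)]
    have := abs_integral_exp_abs_le hc v
    calc _ ≤ C * Real.exp (c * |α|) * (Real.exp (c * |v|) / c) := by gcongr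
      _ = _ := by ring
  have h2 := intervalIntegral.norm_integral_le_abs_of_norm_le (μ := MeasureTheory.volume)
      (f := fun α => ∫ β in (0 : ℝ)..v, F α β) (a := 0) (b := u)
      (g := fun α => (C * (Real.exp (c * |v|) / c)) * Real.exp (c * |α|))
      (by
        filter_upwards [MeasureTheory.ae_restrict_mem measurableSet_uIoc] with α hα
        exact inner α hα)
      ((continuous_const.mul hcont).intervalIntegrable _ _)
  refine h2.trans ?_
  rw [intervalIntegral.integral_const_mul, abs_mul, abs_of_nonneg (by positivity)]
  have := abs_integral_exp_abs_le hc u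
  calc _ ≤ C * (Real.exp (c * |v|) / c) * (Real.exp (c * |u|) / c) := by gcongr
    _ = _ := by field_simp

theorem continuous_double_integral {F : ℝ → ℝ → ℂ} (hF : Continuous fun p : ℝ × ℝ => F p.1 p.2) :
    Continuous fun p : ℝ × ℝ => ∫ α in (0 : ℝ)..p.1, ∫ β in (0 : ℝ)..p.2, F α β := by
  have h1 : Continuous fun x : (ℝ × ℝ) × ℝ => ∫ β in (0 : ℝ)..x.1.2, F x.2 β := by
    apply intervalIntegral.continuous_parametric_intervalIntegral_of_continuous
      (f := fun (x : (ℝ × ℝ) × ℝ) β => F x.2 β)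
    · exact hF.comp (by fun_prop : Continuous fun y : ((ℝ × ℝ) × ℝ) × ℝ => (y.1.2, y.2))
    · fun_prop
  exact intervalIntegral.continuous_parametric_intervalIntegral_of_continuous
      (f := fun (p : ℝ × ℝ) α => ∫ β in (0 : ℝ)..p.2, F α β) h1 continuous_fst

/-- The integral equation equivalent to the Goursat problem is solvable on the whole plane when
the potential is continuous and bounded. -/
theorem exists_integral_equation {Q : ℝ → ℂ} (hQ : Continuous Q) {M : ℝ} (hM : ∀ x, ‖Q x‖ ≤ M) :
    ∃ H : ℝ → ℝ → ℂ, Continuous (fun p : ℝ × ℝ => H p.1 p.2) ∧ ∀ u v : ℝ,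
      H u v = (1 / 2) * (∫ s in (0 : ℝ)..u, Q s)
        + ∫ α in (0 : ℝ)..u, ∫ β in (0 : ℝ)..v, Q (α + β) * H α β := by
  have hM0 : 0 ≤ M := (norm_nonneg _).trans (hM 0)
  set c : ℝ := 2 * M + 1 with hcdef
  have hc : 0 < c := by positivity
  have hMc : M / c ^ 2 ≤ 1 / 2 := by
    rw [div_le_iff₀ (by positivity)]; nlinarith
  let w : ℝ × ℝ → ℝ := fun p => Real.exp (c * |p.1|) * Real.exp (c * |p.2|)
  have hw : Continuous w := by fun_prop
  have hwpos : ∀ p, 0 < w p := fun p => by positivity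
  let R : (ℝ × ℝ → ℂ) → ℝ × ℝ → ℂ := fun G p =>
    ∫ α in (0 : ℝ)..p.1, ∫ β in (0 : ℝ)..p.2, Q (α + β) * (w (α, β) * G (α, β))
  have hRcont : ∀ G : ℝ × ℝ → ℂ, Continuous G → Continuous (R G) := by
    intro G hG
    apply continuous_double_integral (F := fun α β => Q (α + β) * (w (α, β) * G (α, β)))
    have : Continuous fun p : ℝ × ℝ => (w p : ℂ) := Complex.continuous_ofReal.comp hw
    exact (hQ.comp (by fun_prop)).mul (this.mul hG)
  have hRbd : ∀ (G : ℝ × ℝ → ℂ) (C : ℝ), 0 ≤ C → (∀ p, ‖G p‖ ≤ C) →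
      ∀ p, ‖R G p‖ ≤ C / 2 * w p := by
    intro G C hC hG p
    have h1 := norm_double_integral_le hc (C := M * C) (by positivity)
      (F := fun α β => Q (α + β) * (w (α, β) * G (α, β))) (u := p.1) (v := p.2)
      (by
        intro α _ β _
        rw [norm_mul, norm_mul, Complex.norm_real, Real.norm_of_nonneg (hwpos _).le]
        calc _ ≤ M * (w (α, β) * C) := by
              have h5 := hwpos (α, β)
              have h6 := hM (α + β)
              have h7 := hG (α, β)
              gcongr
          _ = _ := by simp only [w]; ring)
    refine h1.trans ?_
    have : M * C / c ^ 2 ≤ C / 2 := by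
      have := mul_le_mul_of_nonneg_right hMc hC
      calc _ = M / c ^ 2 * C := by ring
        _ ≤ _ := this
        _ = _ := by ring
    exact mul_le_mul_of_nonneg_right this (hwpos p).le
  let φ : ℝ × ℝ → ℂ := fun p => (1 / 2) * ∫ s in (0 : ℝ)..p.1, Q s
  have hφ : Continuous φ := by
    have : Continuous fun u : ℝ => ∫ s in (0 : ℝ)..u, Q s :=
      intervalIntegral.continuous_primitive (fun a b => hQ.intervalIntegrable a b) 0
    exact continuous_const.mul (this.comp continuous_fst)
  have hφbd : ∀ p, ‖φ p‖ ≤ M * w p := by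
    intro p
    have h1 : ‖∫ s in (0 : ℝ)..p.1, Q s‖ ≤ M * |p.1 - 0| :=
      intervalIntegral.norm_integral_le_of_norm_le_const (fun x _ => hM x)
    have h2 : |p.1| ≤ w p := by
      have h3 : |p.1| ≤ Real.exp (c * |p.1|) := by
        have := Real.add_one_le_exp (c * |p.1|)
        have hp := abs_nonneg p.1
        nlinarith
      have h4 : 1 ≤ Real.exp (c * |p.2|) := Real.one_le_exp (by positivity)
      have h5 : 0 < Real.exp (c * |p.1|) := Real.exp_pos _
      simp only [w]; nlinarith
    simp only [φ, norm_mul]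
    rw [sub_zero] at h1
    have h6 : ‖(1 / 2 : ℂ)‖ = 1 / 2 := by norm_num
    rw [h6]
    have h7 : M * |p.1| ≤ M * w p := by gcongr
    nlinarith [norm_nonneg (∫ s in (0 : ℝ)..p.1, Q s)]
  let Φ : (ℝ × ℝ →ᵇ ℂ) → (ℝ × ℝ →ᵇ ℂ) := fun G =>
    BoundedContinuousFunction.ofNormedAddCommGroup
      (fun p => ((w p)⁻¹ : ℝ) * (φ p + R G p))
      ((Complex.continuous_ofReal.comp (hw.inv₀ fun p => (hwpos p).ne')).mul
        (hφ.add (hRcont G G.continuous)))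
      (M + ‖G‖ / 2)
      (by
        intro p
        rw [norm_mul, Complex.norm_real, Real.norm_of_nonneg (inv_nonneg.2 (hwpos p).le),
          inv_mul_le_iff₀ (hwpos p)]
        have h1 := hφbd p
        have h2 := hRbd G ‖G‖ (norm_nonneg _) G.norm_coe_le_norm p
        have h3 := norm_add_le (φ p) (R G p)
        linarith)
  have hΦ : ContractingWith (1 / 2) Φ := by
    refine ⟨by norm_num, LipschitzWith.of_dist_le_mul fun G₁ G₂ => ?_⟩
    rw [BoundedContinuousFunction.dist_le (by positivity)]
    intro p
    have h1 : R G₁ p - R G₂ p = R (fun x => G₁ x - G₂ x) p := by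
      simp only [R]
      have hc1 : ∀ G : ℝ × ℝ →ᵇ ℂ, Continuous fun x : ℝ × ℝ =>
          Q (x.1 + x.2) * (w (x.1, x.2) * G (x.1, x.2)) := by
        intro G
        have : Continuous fun p : ℝ × ℝ => (w p : ℂ) := Complex.continuous_ofReal.comp hw
        exact (hQ.comp (by fun_prop)).mul (this.mul G.continuous)
      have hc2 : ∀ G : ℝ × ℝ →ᵇ ℂ, Continuous fun α : ℝ =>
          ∫ β in (0 : ℝ)..p.2, Q (α + β) * (w (α, β) * G (α, β)) := fun G =>
        intervalIntegral.continuous_parametric_intervalIntegral_of_continuous'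
          (f := fun α β => Q (α + β) * (w (α, β) * G (α, β))) (hc1 G) 0 p.2
      rw [← intervalIntegral.integral_sub ((hc2 G₁).intervalIntegrable _ _)
        ((hc2 G₂).intervalIntegrable _ _)]
      congr 1; ext α
      have hc3 : ∀ G : ℝ × ℝ →ᵇ ℂ, Continuous fun β : ℝ =>
          Q (α + β) * (w (α, β) * G (α, β)) := fun G =>
        (hc1 G).comp (by fun_prop : Continuous fun β : ℝ => (α, β))
      rw [← intervalIntegral.integral_sub ((hc3 G₁).intervalIntegrable _ _)
        ((hc3 G₂).intervalIntegrable _ _)]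
      congr 1; ext β
      ring
    have h2 := hRbd (fun x => G₁ x - G₂ x) (dist G₁ G₂) dist_nonneg
      (fun x => by rw [← dist_eq_norm]; exact BoundedContinuousFunction.dist_coe_le_dist x) p
    have h3 : Φ G₁ p - Φ G₂ p = ((w p)⁻¹ : ℝ) * (R G₁ p - R G₂ p) := by
      simp only [Φ, BoundedContinuousFunction.coe_ofNormedAddCommGroup]; ring
    rw [dist_eq_norm, h3, h1, norm_mul, Complex.norm_real,
      Real.norm_of_nonneg (inv_nonneg.2 (hwpos p).le), inv_mul_le_iff₀ (hwpos p)]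
    refine h2.trans (le_of_eq ?_)
    push_cast; ring
  obtain ⟨G, hG⟩ : ∃ G, Φ G = G := ⟨_, hΦ.fixedPoint_isFixedPt⟩
  refine ⟨fun u v => w (u, v) * G (u, v), ?_, fun u v => ?_⟩
  · have : Continuous fun p : ℝ × ℝ => (w p : ℂ) := Complex.continuous_ofReal.comp hw
    exact this.mul G.continuous
  · have h1 : G (u, v) = ((w (u, v))⁻¹ : ℝ) * (φ (u, v) + R G (u, v)) :=
      (DFunLike.congr_fun hG (u, v)).symm
    have h2 : (w (u, v) : ℂ) ≠ 0 := by exact_mod_cast (hwpos _).ne'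
    have h3 : (w (u, v) : ℂ) * G (u, v) = φ (u, v) + R G (u, v) := by
      rw [h1]; push_cast; field_simp
    exact h3

theorem exists_isGoursatSolution {a : ℝ} (ha : 0 ≤ a) {q : ℝ → ℂ}
    (hq : ContinuousOn q (Set.Icc (-a) a)) : ∃ H, IsGoursatSolution a q H := by
  have hle : -a ≤ a := by linarith
  let Q : ℝ → ℂ := Set.IccExtend hle ((Set.Icc (-a) a).domRestrict q)
  have hQ : Continuous Q := (continuousOn_iff_continuous_domRestrict.1 hq).Icc_extend'
  have hQq : ∀ x, |x| ≤ a → Q x = q x := fun x hx =>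
    Set.IccExtend_of_mem hle _ (abs_le.1 hx)
  obtain ⟨M, hM⟩ : ∃ M : ℝ, ∀ x, ‖Q x‖ ≤ M := by
    obtain ⟨M, hM⟩ := isCompact_Icc.exists_bound_of_continuousOn hq
    exact ⟨M, fun x => hM _ (Set.projIcc (-a) a hle x).2⟩
  obtain ⟨H, hH, hHeq⟩ := exists_integral_equation hQ hM
  have hF : Continuous fun p : ℝ × ℝ => Q (p.1 + p.2) * H p.1 p.2 :=
    (hQ.comp (by fun_prop)).mul hH
  let Du : ℝ → ℝ → ℂ := fun u v => (1 / 2) * Q u + ∫ β in (0 : ℝ)..v, Q (u + β) * H u β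
  let Dv : ℝ → ℝ → ℂ := fun u v => ∫ α in (0 : ℝ)..u, Q (α + v) * H α v
  have hDu : ∀ u v, HasDerivAt (fun u' => H u' v) (Du u v) u := by
    intro u v
    have h1 : (fun u' => H u' v) = fun u' => (1 / 2) * (∫ s in (0 : ℝ)..u', Q s)
        + ∫ α in (0 : ℝ)..u', ∫ β in (0 : ℝ)..v, Q (α + β) * H α β := by
      ext u'; exact hHeq u' v
    rw [h1]
    refine HasDerivAt.add ?_ ?_
    · exact (hQ.integral_hasStrictDerivAt 0 u).hasDerivAt.const_mul _
    · have h2 : Continuous fun α : ℝ => ∫ β in (0 : ℝ)..v, Q (α + β) * H α β :=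
        intervalIntegral.continuous_parametric_intervalIntegral_of_continuous'
          (f := fun α β => Q (α + β) * H α β) hF 0 v
      exact (h2.integral_hasStrictDerivAt 0 u).hasDerivAt
  have hswap : ∀ u v, (∫ α in (0 : ℝ)..u, ∫ β in (0 : ℝ)..v, Q (α + β) * H α β)
      = ∫ β in (0 : ℝ)..v, ∫ α in (0 : ℝ)..u, Q (α + β) * H α β := by
    intro u v
    refine MeasureTheory.intervalIntegral_intervalIntegral_swap
      (F := fun α β => Q (α + β) * H α β) ?_
    exact (hF.continuousOn.integrableOn_compact
      (isCompact_uIcc.prod isCompact_uIcc)).mono_set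
      (Set.prod_mono Set.uIoc_subset_uIcc Set.uIoc_subset_uIcc)
  have hDv : ∀ u v, HasDerivAt (fun v' => H u v') (Dv u v) v := by
    intro u v
    have h1 : (fun v' => H u v') = fun v' => (1 / 2) * (∫ s in (0 : ℝ)..u, Q s)
        + ∫ β in (0 : ℝ)..v', ∫ α in (0 : ℝ)..u, Q (α + β) * H α β := by
      ext v'; rw [hHeq u v', hswap]
    rw [h1]
    refine HasDerivAt.const_add _ ?_
    have h2 : Continuous fun β : ℝ => ∫ α in (0 : ℝ)..u, Q (α + β) * H α β :=
      intervalIntegral.continuous_parametric_intervalIntegral_of_continuous'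
        (f := fun β α => Q (α + β) * H α β)
        (hF.comp (by fun_prop : Continuous fun p : ℝ × ℝ => (p.2, p.1))) 0 u
    exact (h2.integral_hasStrictDerivAt 0 v).hasDerivAt
  have hDuc : Continuous fun p : ℝ × ℝ => Du p.1 p.2 := by
    refine (continuous_const.mul (hQ.comp continuous_fst)).add ?_
    exact intervalIntegral.continuous_parametric_intervalIntegral_of_continuous
      (f := fun (p : ℝ × ℝ) β => Q (p.1 + β) * H p.1 β)
      (hF.comp (by fun_prop : Continuous fun y : (ℝ × ℝ) × ℝ => (y.1.1, y.2))) continuous_snd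
  have hDvc : Continuous fun p : ℝ × ℝ => Dv p.1 p.2 :=
    intervalIntegral.continuous_parametric_intervalIntegral_of_continuous
      (f := fun (p : ℝ × ℝ) α => Q (α + p.2) * H α p.2)
      (hF.comp (by fun_prop : Continuous fun y : (ℝ × ℝ) × ℝ => (y.2, y.1.2))) continuous_fst
  refine ⟨H, ⟨?_, ?_, ?_, ?_⟩⟩
  · refine ContDiff.contDiffOn ?_
    let L : ℂ →L[ℝ] (ℝ →L[ℝ] ℂ) := ContinuousLinearMap.smulRightL ℝ ℝ ℂ (1 : ℝ →L[ℝ] ℝ)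
    have hLu : Continuous fun p : ℝ × ℝ => L (Du p.1 p.2) := L.continuous.comp hDuc
    have hLv : Continuous fun p : ℝ × ℝ => L (Dv p.1 p.2) := L.continuous.comp hDvc
    rw [contDiff_one_iff_hasFDerivAt]
    refine ⟨fun p => (L (Du p.1 p.2)).coprod (L (Dv p.1 p.2)), ?_, fun p => ?_⟩
    · have : Continuous fun x : (ℝ →L[ℝ] ℂ) × (ℝ →L[ℝ] ℂ) => x.1.coprod x.2 :=
        (ContinuousLinearMap.coprodEquivL ℝ).continuous
      exact this.comp (hLu.prodMk hLv)
    · exact (hasStrictFDerivAt_uncurry_coprod (𝕜 := ℝ) (u := p) (f := H)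
        (f₁ := fun u v => L (Du u v)) (f₂ := fun u v => L (Dv u v))
        (Filter.Eventually.of_forall fun x => (hDu x.1 x.2).hasFDerivAt)
        (Filter.Eventually.of_forall fun x => (hDv x.1 x.2).hasFDerivAt)
        hLu.continuousAt hLv.continuousAt).hasFDerivAt
  · intro u v huv
    have h1 : (fun v' : ℝ => deriv (fun u' : ℝ => H u' v') u) = fun v' => Du u v' := by
      ext v'; exact (hDu u v').deriv
    rw [h1, ← hQq (u + v) ((abs_add_le u v).trans huv.le)]
    refine HasDerivAt.const_add _ ?_
    exact ((hF.comp (by fun_prop : Continuous fun β : ℝ => (u, β))).integral_hasStrictDerivAt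
      0 v).hasDerivAt
  · intro u hu
    rw [hHeq u 0]
    simp only [intervalIntegral.integral_same, intervalIntegral.integral_zero, add_zero]
    congr 1
    refine intervalIntegral.integral_congr fun s hs => hQq s ?_
    have := Set.abs_sub_left_of_mem_uIcc hs
    simp only [sub_zero] at this
    exact this.trans hu
  · intro v _
    rw [hHeq 0 v]; simp

theorem IsGoursatSolution.unique {a : ℝ} {q : ℝ → ℂ} (hq : ContinuousOn q (Set.Icc (-a) a))
    {H₁ H₂ : ℝ → ℝ → ℂ} (h₁ : IsGoursatSolution a q H₁) (h₂ : IsGoursatSolution a q H₂)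
    {u v : ℝ} (huv : |u| + |v| ≤ a) : H₁ u v = H₂ u v := by
  have hrect : ∀ {u v α β : ℝ}, α ∈ Set.uIcc 0 u → β ∈ Set.uIcc 0 v → |α| + |β| ≤ |u| + |v| := by
    intro u v α β hα hβ
    have h1 := Set.abs_sub_left_of_mem_uIcc hα
    have h2 := Set.abs_sub_left_of_mem_uIcc hβ
    simp only [sub_zero] at h1 h2
    linarith
  -- the integral equation for the difference of two boundary values
  have inteq : ∀ {H : ℝ → ℝ → ℂ}, IsGoursatSolution a q H → ∀ u v : ℝ, |u| + |v| < a →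
      H u v = H u 0 + (∫ α in (0 : ℝ)..u, ∫ β in (0 : ℝ)..v, q (α + β) * H α β) ∧
      IntervalIntegrable (fun α => ∫ β in (0 : ℝ)..v, q (α + β) * H α β)
        MeasureTheory.volume 0 u ∧
      ∀ α ∈ Set.uIcc 0 u, IntervalIntegrable (fun β => q (α + β) * H α β)
        MeasureTheory.volume 0 v := by
    intro H h u v huv
    have hdiff : ∀ v' : ℝ, |v'| ≤ |v| →
        (∫ α in (0 : ℝ)..u, deriv (fun u' => H u' v') α) = H u v' - H 0 v' ∧
        IntervalIntegrable (fun α => deriv (fun u' => H u' v') α) MeasureTheory.volume 0 u := by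
      intro v' hv'
      have hopen : IsOpen {α : ℝ | |α| + |v'| < a} :=
        isOpen_lt (by fun_prop) continuous_const
      have hc : ContDiffOn ℝ 1 (fun u' => H u' v') {α : ℝ | |α| + |v'| < a} := by
        have : ContDiffOn ℝ 1 (fun u' : ℝ => (u', v')) {α : ℝ | |α| + |v'| < a} := by
          fun_prop
        exact h.contDiffOn.comp this fun α (hα : |α| + |v'| < a) => hα.le
      have hsub : Set.uIcc 0 u ⊆ {α : ℝ | |α| + |v'| < a} := by
        intro α hα
        have := hrect hα (Set.right_mem_uIcc : v' ∈ Set.uIcc 0 v')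
        simp only [Set.mem_ofPred_eq]; linarith
      have hci : IntervalIntegrable (fun α => deriv (fun u' => H u' v') α)
          MeasureTheory.volume 0 u :=
        ((hc.continuousOn_deriv_of_isOpen hopen le_rfl).mono hsub).intervalIntegrable
      refine ⟨intervalIntegral.integral_eq_sub_of_hasDerivAt
        (f := fun u' => H u' v') (fun α hα => ?_) hci, hci⟩
      exact ((hc.differentiableOn one_ne_zero).differentiableAt
        (hopen.mem_nhds (hsub hα))).hasDerivAt
    have h1 := hdiff v le_rfl
    have h2 := hdiff 0 (by simp)
    have hv : |v| ≤ a := by have := abs_nonneg u; linarith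
    have ha : 0 ≤ a := (abs_nonneg v).trans hv
    have hint : ∀ α ∈ Set.uIcc 0 u, IntervalIntegrable (fun β => q (α + β) * H α β)
        MeasureTheory.volume 0 v := by
      intro α hα
      refine ContinuousOn.intervalIntegrable (ContinuousOn.mul ?_ ?_)
      · refine hq.comp (by fun_prop) fun β hβ => ?_
        have := hrect hα hβ
        exact abs_le.1 ((abs_add_le α β).trans (by linarith))
      · exact h.contDiffOn.continuousOn.comp (f := fun β : ℝ => (α, β)) (by fun_prop)
          fun β hβ => (hrect hα hβ).trans huv.le
    have h3 : ∀ α ∈ Set.uIcc 0 u, (∫ β in (0 : ℝ)..v, q (α + β) * H α β)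
        = deriv (fun u' => H u' v) α - deriv (fun u' => H u' 0) α := fun α hα =>
      intervalIntegral.integral_eq_sub_of_hasDerivAt
        (f := fun v' => deriv (fun u' => H u' v') α)
        (fun β hβ => h.equation α β ((hrect hα hβ).trans_lt huv)) (hint α hα)
    refine ⟨?_, ?_, hint⟩
    · rw [intervalIntegral.integral_congr h3, intervalIntegral.integral_sub h1.2 h2.2, h1.1, h2.1,
        h.boundary_v v hv, h.boundary_v 0 (by simpa using ha)]
      ring
    · exact (h1.2.sub h2.2).congr fun α hα => (h3 α (Set.uIoc_subset_uIcc hα)).symm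
  obtain ⟨M, hM⟩ := isCompact_Icc.exists_bound_of_continuousOn hq
  have ha : 0 ≤ a := le_trans (by positivity) huv
  have hM0 : 0 ≤ M := (norm_nonneg _).trans (hM 0 ⟨by linarith, ha⟩)
  set c : ℝ := 2 * M + 1 with hcdef
  have hc : 0 < c := by positivity
  have hMc : M / c ^ 2 ≤ 1 / 2 := by
    rw [div_le_iff₀ (by positivity)]; nlinarith
  let w : ℝ × ℝ → ℝ := fun p => Real.exp (c * |p.1|) * Real.exp (c * |p.2|)
  have hw : Continuous w := by fun_prop
  have hwpos : ∀ p, 0 < w p := fun p => by positivity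
  let W : ℝ × ℝ → ℂ := fun p => H₁ p.1 p.2 - H₂ p.1 p.2
  have hW : ContinuousOn W (closedDiamond a) :=
    h₁.contDiffOn.continuousOn.sub h₂.contDiffOn.continuousOn
  have hWeq : ∀ u v : ℝ, |u| + |v| < a →
      W (u, v) = ∫ α in (0 : ℝ)..u, ∫ β in (0 : ℝ)..v, q (α + β) * W (α, β) := by
    intro u v huv
    obtain ⟨e₁, i₁, j₁⟩ := inteq h₁ u v huv
    obtain ⟨e₂, i₂, j₂⟩ := inteq h₂ u v huv
    have hu : |u| ≤ a := by have := abs_nonneg v; linarith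
    have h3 : ∀ α ∈ Set.uIcc 0 u, (∫ β in (0 : ℝ)..v, q (α + β) * W (α, β))
        = (∫ β in (0 : ℝ)..v, q (α + β) * H₁ α β) - ∫ β in (0 : ℝ)..v, q (α + β) * H₂ α β := by
      intro α hα
      rw [← intervalIntegral.integral_sub (j₁ α hα) (j₂ α hα)]
      congr 1; ext β
      simp only [W]; ring
    rw [intervalIntegral.integral_congr h3, intervalIntegral.integral_sub i₁ i₂]
    simp only [W]
    rw [e₁, e₂, h₁.boundary_u u hu, h₂.boundary_u u hu]
    ring
  have hzero : ∀ u v : ℝ, |u| + |v| < a → W (u, v) = 0 := by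
    intro u v huv
    set b := |u| + |v| with hb
    have hcompact : IsCompact (closedDiamond b) := by
      refine (isCompact_Icc.prod isCompact_Icc : IsCompact
        (Set.Icc (-b) b ×ˢ Set.Icc (-b) b)).of_isClosed_subset
        (isClosed_le (by fun_prop) continuous_const) fun p hp => ?_
      have hp' : |p.1| + |p.2| ≤ b := hp
      have h1 := abs_nonneg p.1
      have h2 := abs_nonneg p.2
      exact ⟨abs_le.1 (by linarith), abs_le.1 (by linarith)⟩
    have hbW : ContinuousOn (fun p => ‖W p‖ / w p) (closedDiamond b) := by
      refine ContinuousOn.div (hW.norm.mono fun p hp => ?_) hw.continuousOn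
        fun p _ => (hwpos p).ne'
      exact le_trans hp huv.le
    obtain ⟨p, hp, hpmax⟩ := hcompact.exists_isMaxOn ⟨(u, v), le_of_eq hb.symm⟩ hbW
    set S := ‖W p‖ / w p with hS
    have hS0 : 0 ≤ S := div_nonneg (norm_nonneg _) (hwpos p).le
    have hp' : |p.1| + |p.2| ≤ b := hp
    have hbd : ∀ x : ℝ × ℝ, |x.1| + |x.2| ≤ b → ‖W x‖ ≤ S * w x := fun x hx =>
      (div_le_iff₀ (hwpos x)).1 (hpmax (show x ∈ closedDiamond b from hx))
    have h3 := norm_double_integral_le hc (C := M * S) (by positivity)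
      (F := fun α β => q (α + β) * W (α, β)) (u := p.1) (v := p.2) (by
        intro α hα β hβ
        have h4 := hrect (Set.uIoc_subset_uIcc hα) (Set.uIoc_subset_uIcc hβ)
        have h5 := hbd (α, β) (h4.trans hp')
        have h6 := hM (α + β) (abs_le.1 ((abs_add_le α β).trans (by linarith)))
        rw [norm_mul]
        calc _ ≤ M * (S * w (α, β)) := by gcongr
          _ = _ := by simp only [w]; ring)
    rw [← hWeq p.1 p.2 (hp'.trans_lt huv)] at h3
    have h7 : S ≤ M * S / c ^ 2 := by
      rw [hS, div_le_iff₀ (hwpos p)]; exact h3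
    have h8 : M * S / c ^ 2 ≤ S / 2 := by
      have := mul_le_mul_of_nonneg_right hMc hS0
      calc _ = M / c ^ 2 * S := by ring
        _ ≤ _ := this
        _ = _ := by ring
    have h9 : S = 0 := by linarith
    have h10 := hbd (u, v) le_rfl
    rw [h9, zero_mul] at h10
    exact norm_le_zero_iff.1 h10
  have hclosure : W (u, v) = 0 := by
    have hr : ∀ r ∈ Set.Ico (0 : ℝ) 1, W (r * u, r * v) = 0 := by
      intro r hr
      by_cases h0 : |u| + |v| = 0
      · have hu : u = 0 := by
          have := abs_nonneg u; have := abs_nonneg v; exact abs_eq_zero.1 (by linarith)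
        simp only [hu, mul_zero, W]
        have : |r * v| ≤ a := by
          have := abs_nonneg u; have := abs_nonneg v
          have : v = 0 := abs_eq_zero.1 (by linarith)
          simpa [this] using ha
        rw [h₁.boundary_v _ this, h₂.boundary_v _ this, sub_zero]
      · refine hzero _ _ ?_
        rw [abs_mul, abs_mul, abs_of_nonneg hr.1, ← mul_add]
        have h1 : 0 < |u| + |v| := lt_of_le_of_ne (by positivity) (Ne.symm h0)
        have h2 := hr.2
        nlinarith
    have hcont : ContinuousOn (fun r : ℝ => W (r * u, r * v)) (Set.Icc 0 1) := by
      refine hW.comp (by fun_prop) fun r hr => ?_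
      change |r * u| + |r * v| ≤ a
      rw [abs_mul, abs_mul, abs_of_nonneg hr.1, ← mul_add]
      have h1 : 0 ≤ |u| + |v| := by positivity
      have h2 := hr.2
      nlinarith
    have h1 : Set.EqOn (fun r : ℝ => W (r * u, r * v)) (fun _ => 0) (Set.Icc 0 1) :=
      Set.EqOn.of_subset_closure (s := Set.Ico 0 1) hr hcont continuousOn_const
        Set.Ico_subset_Icc_self (by rw [closure_Ico zero_ne_one])
    simpa using h1 (Set.right_mem_Icc.2 zero_le_one)
  exact sub_eq_zero.1 hclosure

/-- The solution of the Goursat problem on the closed diamond (it exists and is unique there for a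
continuous potential; outside the diamond the value is arbitrary and never used). -/
noncomputable def goursatSolution (a : ℝ) (q : ℝ → ℂ) : ℝ → ℝ → ℂ :=
  Classical.epsilon (IsGoursatSolution a q)

theorem goursatSolution_spec {a : ℝ} (ha : 0 ≤ a) {q : ℝ → ℂ}
    (hq : ContinuousOn q (Set.Icc (-a) a)) : IsGoursatSolution a q (goursatSolution a q) :=
  Classical.epsilon_spec (exists_isGoursatSolution ha hq)

/-- The basic kernel `K(x, t) = H((x + t) / 2, (x - t) / 2)` on the square `|x|, |t| ≤ a`. -/
noncomputable def basicKernel (a : ℝ) (q : ℝ → ℂ) (x t : ℝ) : ℂ :=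
  goursatSolution a q ((x + t) / 2) ((x - t) / 2)

/-- The kernel `𝐊(x, t; h) = h/2 + K(x, t) + (h/2) ∫_t^x (K(x, s) - K(x, -s)) ds` of the
parametrized family of transmutation operators, on the square `|x|, |t| ≤ a`. -/
noncomputable def transmutationKernel (a : ℝ) (q : ℝ → ℂ) (h : ℂ) (x t : ℝ) : ℂ :=
  h / 2 + basicKernel a q x t
    + h / 2 * ∫ s in t..x, (basicKernel a q x s - basicKernel a q x (-s))

/-- The Volterra integral operator `u ↦ u(x) + ∫_{-x}^x k(x, t) u(t) dt`. -/
noncomputable def volterraOp (k : ℝ → ℝ → ℂ) (u : ℝ → ℂ) (x : ℝ) : ℂ :=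
  u x + ∫ t in (-x)..x, k x t * u t

/-- The transmutation operator `𝐓_h` for the potential `q` on `[-a, a]`. -/
noncomputable def transmutationOp (a : ℝ) (q : ℝ → ℂ) (h : ℂ) : (ℝ → ℂ) → ℝ → ℂ :=
  volterraOp (transmutationKernel a q h)

/-- The operator `A = d²/dx² - q(x)` on `[-a, a]`, with one-sided derivatives at the end points. -/
noncomputable def schrodingerOp (a : ℝ) (q u : ℝ → ℂ) (x : ℝ) : ℂ :=
  derivWithin (derivWithin u (Set.Icc (-a) a)) (Set.Icc (-a) a) x - q x * u x

/-- The Darboux transformed potential `2 (f'/f)² - q`. -/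
noncomputable def darbouxPotential (a : ℝ) (q f : ℝ → ℂ) (x : ℝ) : ℂ :=
  2 * (derivWithin f (Set.Icc (-a) a) x / f x) ^ 2 - q x

/-- The operator `T₂[u](x) = (1/f(x)) (∫_0^x f(η) 𝐓_{1;h}[u'](η) dη + u(0))` on functions that are
continuously differentiable on `[-a, a]`, where `𝐓_{1;h}` belongs to the potential `q`. -/
noncomputable def darbouxTransmutation (a : ℝ) (q f : ℝ → ℂ) (h : ℂ) (u : ℝ → ℂ) (x : ℝ) : ℂ :=
  1 / f x * ((∫ η in (0 : ℝ)..x,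
    f η * transmutationOp a q h (derivWithin u (Set.Icc (-a) a)) η) + u 0)

/-- The kernel
`-(1/f(x)) (∫_{-t}^x ∂_t 𝐊₁(s, t; h) f(s) ds + (h/2) f(-t))`, where `𝐊₁` belongs to `q`. -/
noncomputable def darbouxKernel (a : ℝ) (q f : ℝ → ℂ) (h : ℂ) (x t : ℝ) : ℂ :=
  -(1 / f x) * ((∫ s in (-t)..x,
    derivWithin (fun t' : ℝ => transmutationKernel a q h s t') (Set.Icc (-a) a) t * f s)
      + h / 2 * f (-t))

/-!
The proof works in the characteristic coordinates `u = (x + t) / 2`, `v = (x - t) / 2`, where the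
wave operator becomes `∂²/∂u∂v`. Write `g = f' / f`. The Riccati equation `g' = q₁ - g²`
(`derivWithin_logDeriv`) gives `q₁ = g² + g'`, and the Darboux transformed potential is
`q₂ = g² - g'`.

First, the parametrized kernel `𝐊(x, t; η)` is, in characteristic coordinates, the solution `H` of
the Goursat problem `H_uv = q(u + v) H` with `H(u, 0) = η/2 + (1/2) ∫_0^u q` and `H(0, v) = η/2`
(`exists_transmutationKernel_eq`). This rests on
`IsGoursatIntegralSolution.skewPrimitive_eq_integral`: the integral `D = ∫_t^x (K(x, s) - K(x, -s)) ds` satisfies `D = ∫∫ q (1 + D)`. All Goursat problems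
are treated as integral equations, since `q` is only continuous, and on the whole plane, after a
continuous extension of `q`, so that every derivative is two-sided.

Let `H₁`, `H₂` be these solutions for `(q₁, h)` and `(q₂, -h)`, and put `P = H₁ + H₂`,
`N = H₁ - H₂`. The heart of the matter is that the two second-order problems collapse into the
first-order system `P_u = g N`, `N_v = g P` (`goursat_darboux_system`). Indeed the defects
`R = P_u - g N` and `S = N_v - g P` satisfy `R_v = -g S`, `S_u = -g R` and vanish on the axes
`v = 0` and `u = 0` respectively, so they vanish on the diamond
(`eq_zero_of_characteristic_system`).

In the variables `x`, `t` the system contains the identity `∂_x K₂ + g K₂ = -∂_t K₁`, that is,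
`∂_x (f K₂) = -f ∂_t K₁`. Integrating it from `-t` to `x`, with `K₂(-t, t) = -h/2`, is the kernel
formula (`DarbouxPair.mul_kernel_eq`). Leibniz' rule, the same identity and an integration by parts
show that `f 𝐓_{2;-h}[u]` has the derivative `f 𝐓_{1;h}[u']`
(`DarbouxPair.hasDerivAt_mul_volterraOp`); the boundary terms cancel because `N = g` on `v = 0` and
`P = 0` on `u = 0`. Integration from `0` then gives `T₂ = 𝐓_{2;-h}`.
-/

/-! ### Calculus preliminaries -/

section

variable {H Hu Hv : ℝ → ℝ → ℂ}

/-- Continuous partial derivatives give the total derivative. -/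
theorem hasFDerivAt_of_partial
    (hu : ∀ u v, HasDerivAt (fun u' => H u' v) (Hu u v) u)
    (hv : ∀ u v, HasDerivAt (fun v' => H u v') (Hv u v) v)
    (hcu : Continuous fun p : ℝ × ℝ => Hu p.1 p.2)
    (hcv : Continuous fun p : ℝ × ℝ => Hv p.1 p.2) (p : ℝ × ℝ) :
    HasFDerivAt (fun p : ℝ × ℝ => H p.1 p.2)
      ((ContinuousLinearMap.smulRightL ℝ ℝ ℂ (1 : ℝ →L[ℝ] ℝ) (Hu p.1 p.2)).coprod
        (ContinuousLinearMap.smulRightL ℝ ℝ ℂ (1 : ℝ →L[ℝ] ℝ) (Hv p.1 p.2))) p := by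
  let L : ℂ →L[ℝ] (ℝ →L[ℝ] ℂ) := ContinuousLinearMap.smulRightL ℝ ℝ ℂ (1 : ℝ →L[ℝ] ℝ)
  have hLu : Continuous fun p : ℝ × ℝ => L (Hu p.1 p.2) := L.continuous.comp hcu
  have hLv : Continuous fun p : ℝ × ℝ => L (Hv p.1 p.2) := L.continuous.comp hcv
  exact (hasStrictFDerivAt_uncurry_coprod (𝕜 := ℝ) (u := p) (f := H)
    (f₁ := fun u v => L (Hu u v)) (f₂ := fun u v => L (Hv u v))
    (Filter.Eventually.of_forall fun x => (hu x.1 x.2).hasFDerivAt)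
    (Filter.Eventually.of_forall fun x => (hv x.1 x.2).hasFDerivAt)
    hLu.continuousAt hLv.continuousAt).hasFDerivAt

theorem contDiff_one_of_partial
    (hu : ∀ u v, HasDerivAt (fun u' => H u' v) (Hu u v) u)
    (hv : ∀ u v, HasDerivAt (fun v' => H u v') (Hv u v) v)
    (hcu : Continuous fun p : ℝ × ℝ => Hu p.1 p.2)
    (hcv : Continuous fun p : ℝ × ℝ => Hv p.1 p.2) :
    ContDiff ℝ 1 fun p : ℝ × ℝ => H p.1 p.2 := by
  rw [contDiff_one_iff_hasFDerivAt]
  refine ⟨_, ?_, hasFDerivAt_of_partial hu hv hcu hcv⟩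
  have : Continuous fun x : (ℝ →L[ℝ] ℂ) × (ℝ →L[ℝ] ℂ) => x.1.coprod x.2 :=
    (ContinuousLinearMap.coprodEquivL ℝ).continuous
  exact this.comp (((ContinuousLinearMap.continuous _).comp hcu).prodMk
    ((ContinuousLinearMap.continuous _).comp hcv))

/-- The chain rule along a curve, for a function with continuous partial derivatives. -/
theorem hasDerivAt_comp_of_partial
    (hu : ∀ u v, HasDerivAt (fun u' => H u' v) (Hu u v) u)
    (hv : ∀ u v, HasDerivAt (fun v' => H u v') (Hv u v) v)
    (hcu : Continuous fun p : ℝ × ℝ => Hu p.1 p.2)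
    (hcv : Continuous fun p : ℝ × ℝ => Hv p.1 p.2)
    {b c : ℝ → ℝ} {b' c' y : ℝ} (hb : HasDerivAt b b' y) (hc : HasDerivAt c c' y) :
    HasDerivAt (fun z => H (b z) (c z)) (b' * Hu (b y) (c y) + c' * Hv (b y) (c y)) y := by
  have h := (hasFDerivAt_of_partial hu hv hcu hcv (b y, c y)).comp_hasDerivAt y (hb.prodMk hc)
  simpa [Function.comp_def] using h

end

theorem integral_integral_swap_of_continuous {F : ℝ → ℝ → ℂ}
    (hF : Continuous fun p : ℝ × ℝ => F p.1 p.2) (u v : ℝ) :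
    (∫ α in (0 : ℝ)..u, ∫ β in (0 : ℝ)..v, F α β)
      = ∫ β in (0 : ℝ)..v, ∫ α in (0 : ℝ)..u, F α β :=
  MeasureTheory.intervalIntegral_intervalIntegral_swap
    ((hF.continuousOn.integrableOn_compact (isCompact_uIcc.prod isCompact_uIcc)).mono_set
      (Set.prod_mono Set.uIoc_subset_uIcc Set.uIoc_subset_uIcc))

/-- Leibniz' rule for an integral whose integrand and upper limit both depend on the parameter. -/
theorem hasDerivAt_integral_param {k k' : ℝ → ℝ → ℂ}
    (hk : ∀ y t, HasDerivAt (fun y' => k y' t) (k' y t) y)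
    (hkc : Continuous fun p : ℝ × ℝ => k p.1 p.2)
    (hkc' : Continuous fun p : ℝ × ℝ => k' p.1 p.2)
    {b : ℝ → ℝ} {b' y : ℝ} (hb : HasDerivAt b b' y) :
    HasDerivAt (fun z => ∫ t in (0 : ℝ)..b z, k z t)
      ((∫ t in (0 : ℝ)..b y, k' y t) + b' * k y (b y)) y := by
  have hslice : ∀ x, Continuous fun t => k x t := fun x =>
    hkc.comp (by fun_prop : Continuous fun t : ℝ => (x, t))
  have hslice' : ∀ t, Continuous fun x => k' x t := fun t =>
    hkc'.comp (by fun_prop : Continuous fun x : ℝ => (x, t))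
  have hu : ∀ z w, HasDerivAt (fun z' => ∫ t in (0 : ℝ)..w, k z' t)
      (∫ t in (0 : ℝ)..w, k' z t) z := by
    intro z w
    -- swapping the order of integration turns this into the fundamental theorem of calculus
    have h1 : (fun z' => ∫ t in (0 : ℝ)..w, k z' t) = fun z' => (∫ t in (0 : ℝ)..w, k 0 t)
        + ∫ s in (0 : ℝ)..z', ∫ t in (0 : ℝ)..w, k' s t := by
      ext z'
      rw [integral_integral_swap_of_continuous hkc', ← sub_eq_iff_eq_add',
        ← intervalIntegral.integral_sub ((hslice z').intervalIntegrable _ _)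
          ((hslice 0).intervalIntegrable _ _)]
      congr 1; ext t
      exact (intervalIntegral.integral_eq_sub_of_hasDerivAt (f := fun z => k z t)
        (fun x _ => hk x t) ((hslice' t).intervalIntegrable _ _)).symm
    rw [h1]
    refine HasDerivAt.const_add _ ?_
    have h2 : Continuous fun s : ℝ => ∫ t in (0 : ℝ)..w, k' s t :=
      intervalIntegral.continuous_parametric_intervalIntegral_of_continuous' hkc' 0 w
    exact (h2.integral_hasStrictDerivAt 0 z).hasDerivAt
  have hv : ∀ z w, HasDerivAt (fun w' => ∫ t in (0 : ℝ)..w', k z t) (k z w) w := fun z w =>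
    ((hslice z).integral_hasStrictDerivAt 0 w).hasDerivAt
  have hcu : Continuous fun p : ℝ × ℝ => ∫ t in (0 : ℝ)..p.2, k' p.1 t :=
    intervalIntegral.continuous_parametric_intervalIntegral_of_continuous
      (f := fun (p : ℝ × ℝ) t => k' p.1 t)
      (hkc'.comp (by fun_prop : Continuous fun y : (ℝ × ℝ) × ℝ => (y.1.1, y.2))) continuous_snd
  have h := hasDerivAt_comp_of_partial (H := fun z w => ∫ t in (0 : ℝ)..w, k z t)
    hu hv hcu hkc (hasDerivAt_id y) hb
  simpa using h

/-- A `C¹` function on `[-a, a]` extends to a `C¹` function on the line. -/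
theorem exists_hasDerivAt_extension {a : ℝ} (ha : 0 < a) {u : ℝ → ℂ}
    (hu : ContDiffOn ℝ 1 u (Set.Icc (-a) a)) :
    ∃ U U' : ℝ → ℂ, Continuous U' ∧ (∀ x, HasDerivAt U (U' x) x) ∧
      (∀ x ∈ Set.Icc (-a) a, U x = u x) ∧
      ∀ x ∈ Set.Icc (-a) a, U' x = derivWithin u (Set.Icc (-a) a) x := by
  have hle : -a ≤ a := by linarith
  have h0 : (0 : ℝ) ∈ Set.Icc (-a) a := ⟨by linarith, ha.le⟩
  have hud : UniqueDiffOn ℝ (Set.Icc (-a) a) := uniqueDiffOn_Icc (by linarith)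
  have hc := hu.continuousOn_derivWithin hud le_rfl
  let U' : ℝ → ℂ := Set.IccExtend hle ((Set.Icc (-a) a).domRestrict
    (derivWithin u (Set.Icc (-a) a)))
  have hU' : Continuous U' := (continuousOn_iff_continuous_domRestrict.1 hc).Icc_extend'
  have hU'e : ∀ x ∈ Set.Icc (-a) a, U' x = derivWithin u (Set.Icc (-a) a) x := fun x hx =>
    Set.IccExtend_of_mem hle _ hx
  refine ⟨fun x => u 0 + ∫ s in (0 : ℝ)..x, U' s, U', hU', fun x =>
    (hU'.integral_hasStrictDerivAt 0 x).hasDerivAt.const_add _, fun x hx => ?_, hU'e⟩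
  have hsub : Set.uIcc 0 x ⊆ Set.Icc (-a) a :=
    Set.OrdConnected.uIcc_subset Set.ordConnected_Icc h0 hx
  have h1 := intervalIntegral.integral_eq_sub_of_hasDeriv_right (f := u) (f' := U')
    (a := 0) (b := x)
    (hu.continuousOn.mono hsub) (fun y hy => ?_) (hU'.intervalIntegrable _ _)
  · simp only [h1]; ring
  · have hy' : y ∈ Set.Ioo (-a) a := by
      rcases le_total 0 x with h | h
      · rw [min_eq_left h, max_eq_right h] at hy
        exact ⟨by linarith [hy.1], by linarith [hy.2, hx.2]⟩
      · rw [min_eq_right h, max_eq_left h] at hy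
        exact ⟨by linarith [hy.1, hx.1], by linarith [hy.2]⟩
    have hyI := Set.Ioo_subset_Icc_self hy'
    rw [hU'e y hyI]
    exact (((hu.differentiableOn one_ne_zero) y hyI).hasDerivWithinAt.hasDerivAt
      (Icc_mem_nhds hy'.1 hy'.2)).hasDerivWithinAt

/-! ### The integral form of the Goursat problem -/

/-- `H` is a continuous solution on the whole plane of the integral form of the Goursat problem
`∂²H/∂u∂v = Q (u + v) H`, `H (u, 0) = η/2 + (1/2) ∫_0^u Q`, `H (0, v) = η/2`. -/
structure IsGoursatIntegralSolution (Q : ℝ → ℂ) (η : ℂ) (H : ℝ → ℝ → ℂ) : Prop where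
  continuous : Continuous fun p : ℝ × ℝ => H p.1 p.2
  equation : ∀ u v : ℝ, H u v = η / 2 + (1 / 2) * (∫ s in (0 : ℝ)..u, Q s)
    + ∫ α in (0 : ℝ)..u, ∫ β in (0 : ℝ)..v, Q (α + β) * H α β

/-- The derivative in `u` of a solution of the integral equation of the Goursat problem. -/
noncomputable def goursatDu (Q : ℝ → ℂ) (H : ℝ → ℝ → ℂ) (u v : ℝ) : ℂ :=
  (1 / 2) * Q u + ∫ β in (0 : ℝ)..v, Q (u + β) * H u β

/-- The derivative in `v` of a solution of the integral equation of the Goursat problem. -/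
noncomputable def goursatDv (Q : ℝ → ℂ) (H : ℝ → ℝ → ℂ) (u v : ℝ) : ℂ :=
  ∫ α in (0 : ℝ)..u, Q (α + v) * H α v

namespace IsGoursatIntegralSolution

variable {Q : ℝ → ℂ} {η : ℂ} {H : ℝ → ℝ → ℂ}

theorem continuous_source (h : IsGoursatIntegralSolution Q η H) (hQ : Continuous Q) :
    Continuous fun p : ℝ × ℝ => Q (p.1 + p.2) * H p.1 p.2 :=
  (hQ.comp (by fun_prop)).mul h.continuous

theorem eq_zero_left (h : IsGoursatIntegralSolution Q η H) (v : ℝ) : H 0 v = η / 2 := by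
  rw [h.equation 0 v]; simp

theorem hasDerivAt_u (h : IsGoursatIntegralSolution Q η H) (hQ : Continuous Q) (u v : ℝ) :
    HasDerivAt (fun u' => H u' v) (goursatDu Q H u v) u := by
  have h1 : (fun u' => H u' v) = fun u' => η / 2 + (1 / 2) * (∫ s in (0 : ℝ)..u', Q s)
      + ∫ α in (0 : ℝ)..u', ∫ β in (0 : ℝ)..v, Q (α + β) * H α β := by
    ext u'; exact h.equation u' v
  rw [h1]
  refine HasDerivAt.add (((hQ.integral_hasStrictDerivAt 0 u).hasDerivAt.const_mul _).const_add _) ?_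
  have h2 : Continuous fun α : ℝ => ∫ β in (0 : ℝ)..v, Q (α + β) * H α β :=
    intervalIntegral.continuous_parametric_intervalIntegral_of_continuous'
      (f := fun α β => Q (α + β) * H α β) (h.continuous_source hQ) 0 v
  exact (h2.integral_hasStrictDerivAt 0 u).hasDerivAt

theorem hasDerivAt_v (h : IsGoursatIntegralSolution Q η H) (hQ : Continuous Q) (u v : ℝ) :
    HasDerivAt (fun v' => H u v') (goursatDv Q H u v) v := by
  have hF := h.continuous_source hQ
  have h1 : (fun v' => H u v') = fun v' => η / 2 + (1 / 2) * (∫ s in (0 : ℝ)..u, Q s)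
      + ∫ β in (0 : ℝ)..v', ∫ α in (0 : ℝ)..u, Q (α + β) * H α β := by
    ext v'
    rw [h.equation u v',
      integral_integral_swap_of_continuous (F := fun α β => Q (α + β) * H α β) hF]
  rw [h1]
  refine HasDerivAt.const_add _ ?_
  have h2 : Continuous fun β : ℝ => ∫ α in (0 : ℝ)..u, Q (α + β) * H α β :=
    intervalIntegral.continuous_parametric_intervalIntegral_of_continuous'
      (f := fun β α => Q (α + β) * H α β)
      (hF.comp (by fun_prop : Continuous fun p : ℝ × ℝ => (p.2, p.1))) 0 u
  exact (h2.integral_hasStrictDerivAt 0 v).hasDerivAt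

theorem hasDerivAt_goursatDu (h : IsGoursatIntegralSolution Q η H) (hQ : Continuous Q)
    (u v : ℝ) : HasDerivAt (fun v' => goursatDu Q H u v') (Q (u + v) * H u v) v :=
  HasDerivAt.const_add _ (((h.continuous_source hQ).comp
    (by fun_prop : Continuous fun β : ℝ => (u, β))).integral_hasStrictDerivAt 0 v).hasDerivAt

theorem hasDerivAt_goursatDv (h : IsGoursatIntegralSolution Q η H) (hQ : Continuous Q)
    (u v : ℝ) : HasDerivAt (fun u' => goursatDv Q H u' v) (Q (u + v) * H u v) u :=
  (((h.continuous_source hQ).comp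
    (by fun_prop : Continuous fun α : ℝ => (α, v))).integral_hasStrictDerivAt 0 u).hasDerivAt

theorem continuous_goursatDu (h : IsGoursatIntegralSolution Q η H) (hQ : Continuous Q) :
    Continuous fun p : ℝ × ℝ => goursatDu Q H p.1 p.2 := by
  refine (continuous_const.mul (hQ.comp continuous_fst)).add ?_
  exact intervalIntegral.continuous_parametric_intervalIntegral_of_continuous
    (f := fun (p : ℝ × ℝ) β => Q (p.1 + β) * H p.1 β)
    ((h.continuous_source hQ).comp
      (by fun_prop : Continuous fun y : (ℝ × ℝ) × ℝ => (y.1.1, y.2))) continuous_snd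

theorem continuous_goursatDv (h : IsGoursatIntegralSolution Q η H) (hQ : Continuous Q) :
    Continuous fun p : ℝ × ℝ => goursatDv Q H p.1 p.2 :=
  intervalIntegral.continuous_parametric_intervalIntegral_of_continuous
    (f := fun (p : ℝ × ℝ) α => Q (α + p.2) * H α p.2)
    ((h.continuous_source hQ).comp
      (by fun_prop : Continuous fun y : (ℝ × ℝ) × ℝ => (y.2, y.1.2))) continuous_fst

theorem contDiff (h : IsGoursatIntegralSolution Q η H) (hQ : Continuous Q) :
    ContDiff ℝ 1 fun p : ℝ × ℝ => H p.1 p.2 :=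
  contDiff_one_of_partial (h.hasDerivAt_u hQ) (h.hasDerivAt_v hQ) (h.continuous_goursatDu hQ)
    (h.continuous_goursatDv hQ)

theorem isGoursatSolution (h : IsGoursatIntegralSolution Q 0 H) (hQ : Continuous Q)
    {a : ℝ} {q : ℝ → ℂ} (hQq : ∀ x ∈ Set.Icc (-a) a, Q x = q x) : IsGoursatSolution a q H := by
  refine ⟨(h.contDiff hQ).contDiffOn, fun u v huv => ?_, fun u hu => ?_, fun v _ => ?_⟩
  · have h1 : (fun v' : ℝ => deriv (fun u' : ℝ => H u' v') u) = fun v' => goursatDu Q H u v' := by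
      ext v'; exact (h.hasDerivAt_u hQ u v').deriv
    rw [h1, ← hQq (u + v) (abs_le.1 ((abs_add_le u v).trans huv.le))]
    exact h.hasDerivAt_goursatDu hQ u v
  · rw [h.equation u 0]
    simp only [intervalIntegral.integral_same, intervalIntegral.integral_zero, add_zero, zero_div,
      zero_add]
    congr 1
    refine intervalIntegral.integral_congr fun s hs => hQq s ?_
    have := Set.abs_sub_left_of_mem_uIcc hs
    simp only [sub_zero] at this
    exact abs_le.1 (this.trans hu)
  · simpa using h.eq_zero_left v

/-! ### Changing the parameter of the kernel -/

/-- The primitive `2 ∫_0^v (H(u + v - β, β) - H(β, u + v - β)) dβ` of the antisymmetric part of `H`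
along the characteristic-coordinate image of a line `x = const`. -/
noncomputable def skewPrimitive (H : ℝ → ℝ → ℂ) (u v : ℝ) : ℂ :=
  2 * ∫ β in (0 : ℝ)..v, (H (u + v - β) β - H β (u + v - β))

theorem continuous_skewPrimitive (hH : Continuous fun p : ℝ × ℝ => H p.1 p.2) :
    Continuous fun p : ℝ × ℝ => skewPrimitive H p.1 p.2 :=
  continuous_const.mul <| intervalIntegral.continuous_parametric_intervalIntegral_of_continuous
    (f := fun (p : ℝ × ℝ) β => H (p.1 + p.2 - β) β - H β (p.1 + p.2 - β))
    ((hH.comp (by fun_prop : Continuous fun y : (ℝ × ℝ) × ℝ => (y.1.1 + y.1.2 - y.2, y.2))).sub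
      (hH.comp (by fun_prop : Continuous fun y : (ℝ × ℝ) × ℝ => (y.2, y.1.1 + y.1.2 - y.2))))
    continuous_snd

theorem skewPrimitive_zero_left (H : ℝ → ℝ → ℂ) (v : ℝ) :
    skewPrimitive H 0 v = 0 := by
  have h1 := intervalIntegral.integral_comp_sub_left (a := 0) (b := v)
    (fun β => H (v - β) β - H β (v - β)) v
  simp only [sub_sub_cancel, sub_self, sub_zero] at h1
  have h2 : (∫ β in (0 : ℝ)..v, (H β (v - β) - H (v - β) β))
      = - ∫ β in (0 : ℝ)..v, (H (v - β) β - H β (v - β)) := by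
    rw [← intervalIntegral.integral_neg]; congr 1; ext β; ring
  rw [h2] at h1
  -- the reflection `β ↦ v - β` changes the sign of the integrand
  have h3 : (∫ β in (0 : ℝ)..v, (H (v - β) β - H β (v - β))) = 0 := by
    linear_combination (-1 / 2 : ℂ) * h1
  simp [skewPrimitive, h3]

/-- With `J(u, v) = H(u, v) - H(v, u)`, the left side is `2 ∫_0^v ∂_u J(x - β, β) dβ`. For fixed `x`
the two sides have the same derivative in `v` and vanish at `v = 0`; this needs no
differentiability of `Q`. -/
theorem integral_skew_goursatDu (h : IsGoursatIntegralSolution Q η H) (hQ : Continuous Q)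
    (x v : ℝ) :
    2 * (∫ β in (0 : ℝ)..v, (goursatDu Q H (x - β) β - goursatDv Q H β (x - β)))
      = ∫ β in (0 : ℝ)..v, Q (x - β) * (1 + skewPrimitive H (x - v) (v - β)) := by
  have hH := h.continuous
  have hQH := h.continuous_source hQ
  -- the common derivative of the two sides
  let E : ℝ → ℂ := fun v => Q (x - v)
    + ∫ c in (0 : ℝ)..v, Q (x - c) * (2 * (H (x - v) (v - c) - H (v - c) (x - v)))
  have hu := h.continuous_goursatDu hQ
  have hv := h.continuous_goursatDv hQ
  have hA : ∀ v, HasDerivAt (fun v => 2 * (∫ β in (0 : ℝ)..v,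
      (goursatDu Q H (x - β) β - goursatDv Q H β (x - β)))) (E v) v := by
    intro v
    have h1 : Continuous fun β : ℝ => goursatDu Q H (x - β) β - goursatDv Q H β (x - β) :=
      (hu.comp (by fun_prop : Continuous fun β : ℝ => (x - β, β))).sub
        (hv.comp (by fun_prop : Continuous fun β : ℝ => (β, x - β)))
    refine ((h1.integral_hasStrictDerivAt 0 v).hasDerivAt.const_mul 2).congr_deriv ?_
    have h2 : (∫ c in (0 : ℝ)..v, Q (x - c) * (2 * (H (x - v) (v - c) - H (v - c) (x - v))))
        = ∫ b in (0 : ℝ)..v, Q (x - v + b) * (2 * (H (x - v) b - H b (x - v))) := by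
      have := intervalIntegral.integral_comp_sub_left (a := 0) (b := v)
        (fun b => Q (x - v + b) * (2 * (H (x - v) b - H b (x - v)))) v
      simp only [sub_self, sub_zero] at this
      rw [← this]
      congr 1; ext c
      rw [show x - v + (v - c) = x - c by ring]
    have i1 : Continuous fun b : ℝ => Q (x - v + b) * H (x - v) b :=
      hQH.comp (by fun_prop : Continuous fun b : ℝ => (x - v, b))
    have i2 : Continuous fun b : ℝ => Q (b + (x - v)) * H b (x - v) :=
      hQH.comp (by fun_prop : Continuous fun b : ℝ => (b, x - v))
    have h3 : (∫ b in (0 : ℝ)..v, Q (x - v + b) * (2 * (H (x - v) b - H b (x - v))))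
        = 2 * ((∫ b in (0 : ℝ)..v, Q (x - v + b) * H (x - v) b)
          - ∫ b in (0 : ℝ)..v, Q (b + (x - v)) * H b (x - v)) := by
      rw [← intervalIntegral.integral_sub (i1.intervalIntegrable _ _) (i2.intervalIntegrable _ _),
        ← intervalIntegral.integral_const_mul]
      congr 1; ext b
      rw [add_comm b]; ring
    simp only [E, h2, h3, goursatDu, goursatDv]
    ring
  have hB : ∀ v, HasDerivAt (fun v => ∫ β in (0 : ℝ)..v,
      Q (x - β) * (1 + skewPrimitive H (x - v) (v - β))) (E v) v := by
    intro v
    have hJ : Continuous fun p : ℝ × ℝ => H p.1 p.2 - H p.2 p.1 :=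
      hH.sub (hH.comp (by fun_prop : Continuous fun p : ℝ × ℝ => (p.2, p.1)))
    have h1 : ∀ y c, HasDerivAt (fun y => Q (x - c) * (1 + skewPrimitive H (x - y) (y - c)))
        (Q (x - c) * (2 * (H (x - y) (y - c) - H (y - c) (x - y)))) y := by
      intro y c
      refine HasDerivAt.const_mul _ (HasDerivAt.const_add _ ?_)
      -- the sum of the arguments of `skewPrimitive` stays equal to `x - c`, so only the upper
      -- limit of the integral depends on `y`
      have h2 : (fun y => skewPrimitive H (x - y) (y - c)) = fun y =>
          2 * ∫ β in (0 : ℝ)..(y - c), (H (x - c - β) β - H β (x - c - β)) := by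
        ext y
        simp only [skewPrimitive]
        rw [show x - y + (y - c) = x - c by ring]
      rw [h2]
      have h3 : Continuous fun β : ℝ => H (x - c - β) β - H β (x - c - β) :=
        hJ.comp (by fun_prop : Continuous fun β : ℝ => (x - c - β, β))
      have h4 := ((h3.integral_hasStrictDerivAt 0 (y - c)).hasDerivAt.scomp y
        ((hasDerivAt_id y).sub_const c)).const_mul (2 : ℂ)
      simp only [Function.comp_def, one_smul, id] at h4
      refine h4.congr_deriv ?_
      rw [show x - c - (y - c) = x - y by ring]
    refine (hasDerivAt_integral_param h1 ?_ ?_ (hasDerivAt_id v)).congr_deriv ?_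
    · exact (hQ.comp (by fun_prop)).mul (continuous_const.add
        ((continuous_skewPrimitive hH).comp
          (by fun_prop : Continuous fun p : ℝ × ℝ => (x - p.1, p.1 - p.2))))
    · exact (hQ.comp (by fun_prop)).mul (continuous_const.mul
        (hJ.comp (by fun_prop : Continuous fun p : ℝ × ℝ => (x - p.1, p.1 - p.2))))
    · simp [E, skewPrimitive, add_comm]
  have hAB : ∀ v, HasDerivAt (fun v => 2 * (∫ β in (0 : ℝ)..v,
      (goursatDu Q H (x - β) β - goursatDv Q H β (x - β))) - ∫ β in (0 : ℝ)..v,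
      Q (x - β) * (1 + skewPrimitive H (x - v) (v - β))) 0 v := fun v =>
    ((hA v).sub (hB v)).congr_deriv (sub_self _)
  have := is_const_of_deriv_eq_zero (fun v => (hAB v).differentiableAt) (fun v => (hAB v).deriv) v 0
  simp only [intervalIntegral.integral_same, mul_zero, sub_zero] at this
  exact sub_eq_zero.1 this

theorem hasDerivAt_skewPrimitive (h : IsGoursatIntegralSolution Q η H) (hQ : Continuous Q)
    (u v : ℝ) : HasDerivAt (fun u => skewPrimitive H u v)
      (∫ β in (0 : ℝ)..v, Q (u + β) * (1 + skewPrimitive H u β)) u := by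
  have hH := h.continuous
  have h1 : ∀ y t, HasDerivAt (fun y => H (y + v - t) t - H t (y + v - t))
      (goursatDu Q H (y + v - t) t - goursatDv Q H t (y + v - t)) y := by
    intro y t
    have e : HasDerivAt (fun y => y + v - t) 1 y := ((hasDerivAt_id y).add_const v).sub_const t
    have e1 := (h.hasDerivAt_u hQ (y + v - t) t).scomp y e
    have e2 := (h.hasDerivAt_v hQ t (y + v - t)).scomp y e
    simp only [Function.comp_def, one_smul] at e1 e2
    exact e1.sub e2
  have h2 := (hasDerivAt_integral_param (y := u) h1 ?_ ?_ (hasDerivAt_const u v)).const_mul (2 : ℂ)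
  · refine h2.congr_deriv ?_
    have h3 := h.integral_skew_goursatDu hQ (u + v) v
    simp only [Complex.ofReal_zero, zero_mul, add_zero]
    rw [h3]
    have := intervalIntegral.integral_comp_sub_left (a := 0) (b := v)
      (fun β => Q (u + β) * (1 + skewPrimitive H u β)) v
    simp only [sub_self, sub_zero] at this
    rw [← this]
    congr 1; ext c
    rw [show u + v - v = u by ring, show u + (v - c) = u + v - c by ring]
  · exact (hH.comp (by fun_prop : Continuous fun p : ℝ × ℝ => (p.1 + v - p.2, p.2))).sub
      (hH.comp (by fun_prop : Continuous fun p : ℝ × ℝ => (p.2, p.1 + v - p.2)))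
  · exact ((h.continuous_goursatDu hQ).comp
        (by fun_prop : Continuous fun p : ℝ × ℝ => (p.1 + v - p.2, p.2))).sub
      ((h.continuous_goursatDv hQ).comp
        (by fun_prop : Continuous fun p : ℝ × ℝ => (p.2, p.1 + v - p.2)))

theorem skewPrimitive_eq_integral (h : IsGoursatIntegralSolution Q η H) (hQ : Continuous Q)
    (u v : ℝ) : skewPrimitive H u v
      = ∫ α in (0 : ℝ)..u, ∫ β in (0 : ℝ)..v, Q (α + β) * (1 + skewPrimitive H α β) := by
  have hc : Continuous fun α : ℝ => ∫ β in (0 : ℝ)..v, Q (α + β) * (1 + skewPrimitive H α β) :=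
    intervalIntegral.continuous_parametric_intervalIntegral_of_continuous'
      (f := fun α β => Q (α + β) * (1 + skewPrimitive H α β))
      ((hQ.comp (by fun_prop)).mul
        (continuous_const.add (continuous_skewPrimitive h.continuous))) 0 v
  rw [intervalIntegral.integral_eq_sub_of_hasDerivAt (f := fun u => skewPrimitive H u v)
    (fun α _ => h.hasDerivAt_skewPrimitive hQ α v) (hc.intervalIntegrable _ _),
    skewPrimitive_zero_left H, sub_zero]

/-- Passing from the parameter `0` to the parameter `η`: the integral equations for `H` and for
`1 + skewPrimitive H` add up. -/
theorem shift (h : IsGoursatIntegralSolution Q 0 H) (hQ : Continuous Q) (η : ℂ) :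
    IsGoursatIntegralSolution Q η fun u v => η / 2 + H u v + η / 2 * skewPrimitive H u v := by
  have hD := continuous_skewPrimitive h.continuous
  refine ⟨(continuous_const.add h.continuous).add (continuous_const.mul hD), fun u v => ?_⟩
  have c1 := h.continuous_source hQ
  have c2 : Continuous fun p : ℝ × ℝ => Q (p.1 + p.2) * (1 + skewPrimitive H p.1 p.2) :=
    (hQ.comp (by fun_prop)).mul (continuous_const.add hD)
  have c1' : ∀ α, Continuous fun β => Q (α + β) * H α β := fun α =>
    c1.comp (by fun_prop : Continuous fun β : ℝ => (α, β))
  have c2' : ∀ α, Continuous fun β => Q (α + β) * (1 + skewPrimitive H α β) := fun α =>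
    c2.comp (by fun_prop : Continuous fun β : ℝ => (α, β))
  have d1 : Continuous fun α : ℝ => ∫ β in (0 : ℝ)..v, Q (α + β) * H α β :=
    intervalIntegral.continuous_parametric_intervalIntegral_of_continuous'
      (f := fun α β => Q (α + β) * H α β) c1 0 v
  have d2 : Continuous fun α : ℝ => ∫ β in (0 : ℝ)..v, Q (α + β) * (1 + skewPrimitive H α β) :=
    intervalIntegral.continuous_parametric_intervalIntegral_of_continuous'
      (f := fun α β => Q (α + β) * (1 + skewPrimitive H α β)) c2 0 v
  have e : ∀ α, (∫ β in (0 : ℝ)..v, Q (α + β) * (η / 2 + H α β + η / 2 * skewPrimitive H α β))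
      = (∫ β in (0 : ℝ)..v, Q (α + β) * H α β)
        + η / 2 * ∫ β in (0 : ℝ)..v, Q (α + β) * (1 + skewPrimitive H α β) := by
    intro α
    rw [← intervalIntegral.integral_const_mul, ← intervalIntegral.integral_add
      ((c1' α).intervalIntegrable _ _) (((c2' α).intervalIntegrable _ _).const_mul _)]
    congr 1; ext β; ring
  simp only [e]
  rw [intervalIntegral.integral_add (d1.intervalIntegrable _ _)
    ((d2.intervalIntegrable _ _).const_mul _), intervalIntegral.integral_const_mul,
    ← h.skewPrimitive_eq_integral hQ, h.equation u v]
  ring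

end IsGoursatIntegralSolution

/-- A continuous function on `[-a, a]` extends to a bounded continuous function on the line. -/
theorem exists_continuous_bounded_extension {a : ℝ} (ha : 0 ≤ a) {q : ℝ → ℂ}
    (hq : ContinuousOn q (Set.Icc (-a) a)) :
    ∃ Q : ℝ → ℂ, Continuous Q ∧ (∃ M : ℝ, ∀ x, ‖Q x‖ ≤ M) ∧ ∀ x ∈ Set.Icc (-a) a, Q x = q x := by
  have hle : -a ≤ a := by linarith
  refine ⟨Set.IccExtend hle ((Set.Icc (-a) a).domRestrict q),
    (continuousOn_iff_continuous_domRestrict.1 hq).Icc_extend', ?_,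
    fun x hx => Set.IccExtend_of_mem hle _ hx⟩
  obtain ⟨M, hM⟩ := isCompact_Icc.exists_bound_of_continuousOn hq
  exact ⟨M, fun x => hM _ (Set.projIcc (-a) a hle x).2⟩

theorem abs_half_add_abs_half_le {a x t : ℝ} (hx : x ∈ Set.Icc (-a) a) (ht : t ∈ Set.Icc (-a) a) :
    |(x + t) / 2| + |(x - t) / 2| ≤ a := by
  obtain ⟨h1, h2⟩ := hx
  obtain ⟨h3, h4⟩ := ht
  rcases abs_cases ((x + t) / 2) with h | h <;> rcases abs_cases ((x - t) / 2) with h' | h' <;>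
    linarith

/-- In characteristic coordinates the parametrized transmutation kernel is the restriction of a
solution of the Goursat problem with `H (0, v) = η / 2`. -/
theorem exists_transmutationKernel_eq {a : ℝ} (ha : 0 ≤ a) {q : ℝ → ℂ}
    (hq : ContinuousOn q (Set.Icc (-a) a)) (η : ℂ) :
    ∃ Q H, Continuous Q ∧ (∀ x ∈ Set.Icc (-a) a, Q x = q x) ∧ IsGoursatIntegralSolution Q η H ∧
      ∀ x ∈ Set.Icc (-a) a, ∀ t ∈ Set.Icc (-a) a,
        transmutationKernel a q η x t = H ((x + t) / 2) ((x - t) / 2) := by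
  obtain ⟨Q, hQ, ⟨M, hM⟩, hQq⟩ := exists_continuous_bounded_extension ha hq
  obtain ⟨H, hHc, hHe⟩ := exists_integral_equation hQ hM
  have hH : IsGoursatIntegralSolution Q 0 H := ⟨hHc, fun u v => by rw [hHe u v]; ring⟩
  refine ⟨Q, _, hQ, hQq, hH.shift hQ η, fun x hx t ht => ?_⟩
  have hK : ∀ s ∈ Set.Icc (-a) a, basicKernel a q x s = H ((x + s) / 2) ((x - s) / 2) :=
    fun s hs => IsGoursatSolution.unique hq (goursatSolution_spec ha hq)
      (hH.isGoursatSolution hQ hQq) (abs_half_add_abs_half_le hx hs)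
  rw [transmutationKernel, hK t ht]
  congr 2
  have h1 : (∫ s in t..x, (basicKernel a q x s - basicKernel a q x (-s)))
      = ∫ s in t..x, (H ((x + s) / 2) ((x - s) / 2) - H ((x - s) / 2) ((x + s) / 2)) := by
    refine intervalIntegral.integral_congr fun s hs => ?_
    have hs' : s ∈ Set.Icc (-a) a := Set.OrdConnected.uIcc_subset Set.ordConnected_Icc ht hx hs
    have hs'' : -s ∈ Set.Icc (-a) a := ⟨by linarith [hs'.2], by linarith [hs'.1]⟩
    rw [hK s hs', hK _ hs'', ← sub_eq_add_neg, sub_neg_eq_add]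
  -- the substitution `s = x - 2β` leads to characteristic coordinates
  have h2 := intervalIntegral.integral_comp_sub_mul (a := 0) (b := (x - t) / 2)
    (fun s => H ((x + s) / 2) ((x - s) / 2) - H ((x - s) / 2) ((x + s) / 2)) two_ne_zero x
  rw [show x - 2 * ((x - t) / 2) = t by ring, mul_zero, sub_zero] at h2
  have h3 : IsGoursatIntegralSolution.skewPrimitive H ((x + t) / 2) ((x - t) / 2)
      = 2 * ∫ s in (0 : ℝ)..(x - t) / 2, (H ((x + (x - 2 * s)) / 2) ((x - (x - 2 * s)) / 2)
        - H ((x - (x - 2 * s)) / 2) ((x + (x - 2 * s)) / 2)) := by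
    rw [IsGoursatIntegralSolution.skewPrimitive]
    congr 2; ext s
    rw [show (x + t) / 2 + (x - t) / 2 - s = (x + (x - 2 * s)) / 2 by ring,
      show (x - (x - 2 * s)) / 2 = s by ring]
  rw [h1, h3, h2, Complex.real_smul]
  push_cast; ring

/-! ### Uniqueness for first-order systems in characteristic coordinates -/

theorem isCompact_closedDiamond (a : ℝ) : IsCompact (closedDiamond a) := by
  refine (isCompact_Icc.prod isCompact_Icc : IsCompact
    (Set.Icc (-a) a ×ˢ Set.Icc (-a) a)).of_isClosed_subset
    (isClosed_le (by fun_prop) continuous_const) fun p hp => ?_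
  have hp' : |p.1| + |p.2| ≤ a := hp
  have h1 := abs_nonneg p.1
  have h2 := abs_nonneg p.2
  exact ⟨abs_le.1 (by linarith), abs_le.1 (by linarith)⟩

theorem abs_le_abs_of_mem_uIcc_zero {s u : ℝ} (hs : s ∈ Set.uIcc 0 u) : |s| ≤ |u| := by
  simpa using Set.abs_sub_left_of_mem_uIcc hs

/-- Integration gains a factor `1 / c` in the norm with weight `e^{c|β|}`. -/
theorem norm_integral_le_of_exp_weight {c C : ℝ} (hc : 0 < c) (hC : 0 ≤ C) {φ : ℝ → ℂ} {v : ℝ}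
    (hφ : ∀ β ∈ Set.uIcc 0 v, ‖φ β‖ ≤ C * Real.exp (c * |β|)) :
    ‖∫ β in (0 : ℝ)..v, φ β‖ ≤ C / c * Real.exp (c * |v|) := by
  have h1 := intervalIntegral.norm_integral_le_abs_of_norm_le (μ := MeasureTheory.volume)
    (f := φ) (a := 0) (b := v) (g := fun β => C * Real.exp (c * |β|))
    (by
      filter_upwards [MeasureTheory.ae_restrict_mem measurableSet_uIoc] with β hβ
      exact hφ β (Set.uIoc_subset_uIcc hβ))
    ((by fun_prop : Continuous fun β : ℝ => C * Real.exp (c * |β|)).intervalIntegrable _ _)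
  refine h1.trans ?_
  rw [intervalIntegral.integral_const_mul, abs_mul, abs_of_nonneg hC]
  calc _ ≤ C * (Real.exp (c * |v|) / c) := by
        have := abs_integral_exp_abs_le hc v
        gcongr
    _ = _ := by ring

/-- A homogeneous first-order system in characteristic coordinates, with zero data on the axes,
has only the zero solution on the diamond: the weighted norm with weight `e^{c(|u| + |v|)}`
makes the integral operators contractions. -/
theorem eq_zero_of_characteristic_system {a : ℝ} {G : ℝ → ℂ} {R S : ℝ → ℝ → ℂ}
    (hG : Continuous G) (hR : Continuous fun p : ℝ × ℝ => R p.1 p.2)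
    (hS : Continuous fun p : ℝ × ℝ => S p.1 p.2)
    (hRe : ∀ u v, |u| + |v| ≤ a → R u v = -∫ β in (0 : ℝ)..v, G (u + β) * S u β)
    (hSe : ∀ u v, |u| + |v| ≤ a → S u v = -∫ α in (0 : ℝ)..u, G (α + v) * R α v)
    {u v : ℝ} (huv : |u| + |v| ≤ a) : R u v = 0 ∧ S u v = 0 := by
  obtain ⟨M, hM⟩ := (isCompact_Icc (a := -a) (b := a)).exists_bound_of_continuousOn hG.continuousOn
  have ha : 0 ≤ a := le_trans (by positivity) huv
  have hM0 : 0 ≤ M := (norm_nonneg _).trans (hM 0 ⟨by linarith, ha⟩)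
  -- each of the two equations contributes `M / c` to the norm, and `2 M / c ≤ 1 / 2`
  set c : ℝ := 4 * M + 1 with hcdef
  have hc : 0 < c := by positivity
  let w : ℝ × ℝ → ℝ := fun p => Real.exp (c * |p.1|) * Real.exp (c * |p.2|)
  have hw : Continuous w := by fun_prop
  have hwpos : ∀ p, 0 < w p := fun p => by positivity
  have hcont : Continuous fun p : ℝ × ℝ => (‖R p.1 p.2‖ + ‖S p.1 p.2‖) / w p :=
    (hR.norm.add hS.norm).div hw fun p => (hwpos p).ne'
  obtain ⟨p, hp, hpmax⟩ := (isCompact_closedDiamond a).exists_isMaxOn ⟨(u, v), huv⟩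
    hcont.continuousOn
  set m := (‖R p.1 p.2‖ + ‖S p.1 p.2‖) / w p with hm
  have hp' : |p.1| + |p.2| ≤ a := hp
  have hm0 : 0 ≤ m := div_nonneg (by positivity) (hwpos p).le
  have hbd : ∀ x y : ℝ, |x| + |y| ≤ a → ‖R x y‖ + ‖S x y‖ ≤ m * w (x, y) := fun x y hxy =>
    (div_le_iff₀ (hwpos (x, y))).1 (hpmax (show (x, y) ∈ closedDiamond a from hxy))
  have h1 : ‖R p.1 p.2‖ ≤ M * m * Real.exp (c * |p.1|) / c * Real.exp (c * |p.2|) := by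
    rw [hRe _ _ hp', norm_neg]
    refine norm_integral_le_of_exp_weight hc (by positivity) fun β hβ => ?_
    have h2 : |p.1| + |β| ≤ a := by linarith [abs_le_abs_of_mem_uIcc_zero hβ]
    have h3 := hM (p.1 + β) (abs_le.1 ((abs_add_le _ _).trans h2))
    have h4 : ‖S p.1 β‖ ≤ m * w (p.1, β) := by
      linarith [hbd _ _ h2, norm_nonneg (R p.1 β)]
    rw [norm_mul]
    calc _ ≤ M * (m * w (p.1, β)) := by gcongr
      _ = _ := by simp only [w]; ring
  have h1' : ‖S p.1 p.2‖ ≤ M * m * Real.exp (c * |p.2|) / c * Real.exp (c * |p.1|) := by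
    rw [hSe _ _ hp', norm_neg]
    refine norm_integral_le_of_exp_weight hc (by positivity) fun α hα => ?_
    have h2 : |α| + |p.2| ≤ a := by linarith [abs_le_abs_of_mem_uIcc_zero hα]
    have h3 := hM (α + p.2) (abs_le.1 ((abs_add_le _ _).trans h2))
    have h4 : ‖R α p.2‖ ≤ m * w (α, p.2) := by
      linarith [hbd _ _ h2, norm_nonneg (S α p.2)]
    rw [norm_mul]
    calc _ ≤ M * (m * w (α, p.2)) := by gcongr
      _ = _ := by simp only [w]; ring
  have h5 : m ≤ 2 * M / c * m := by
    rw [hm, div_le_iff₀ (hwpos p)]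
    calc _ ≤ _ := add_le_add h1 h1'
      _ = 2 * M / c * m * w p := by simp only [w]; ring
  have h6 : 2 * M / c ≤ 1 / 2 := by
    rw [div_le_iff₀ hc]; linarith
  have h7 : m = 0 := by nlinarith
  have h8 := hbd u v huv
  rw [h7, zero_mul] at h8
  exact ⟨norm_le_zero_iff.1 (by linarith [norm_nonneg (S u v)]),
    norm_le_zero_iff.1 (by linarith [norm_nonneg (R u v)])⟩

/-! ### The first-order system linking the two kernels -/

/-- On the axis `v = 0` the difference of the two Goursat solutions is `G`. -/
theorem goursat_darboux_diagonal {a : ℝ} {G G' Q₁ Q₂ : ℝ → ℂ} {H₁ H₂ : ℝ → ℝ → ℂ} {h : ℂ}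
    (hG : ∀ x, HasDerivAt G (G' x) x) (hG' : Continuous G') (hG0 : G 0 = h)
    (hQ₁ : Continuous Q₁) (hQ₂ : Continuous Q₂)
    (hQ₁G : ∀ x ∈ Set.Icc (-a) a, Q₁ x = G x ^ 2 + G' x)
    (hQ₂G : ∀ x ∈ Set.Icc (-a) a, Q₂ x = G x ^ 2 - G' x)
    (h₁ : IsGoursatIntegralSolution Q₁ h H₁) (h₂ : IsGoursatIntegralSolution Q₂ (-h) H₂)
    (x : ℝ) (hx : |x| ≤ a) : H₁ x 0 - H₂ x 0 = G x := by
  have e : ∫ s in (0 : ℝ)..x, (Q₁ s - Q₂ s) = 2 * (G x - h) := by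
    have e1 : ∫ s in (0 : ℝ)..x, (Q₁ s - Q₂ s) = ∫ s in (0 : ℝ)..x, 2 * G' s := by
      refine intervalIntegral.integral_congr fun s hs => ?_
      have hs' := abs_le.1 ((abs_le_abs_of_mem_uIcc_zero hs).trans hx)
      simp only [hQ₁G s hs', hQ₂G s hs']; ring
    rw [e1, intervalIntegral.integral_const_mul,
      intervalIntegral.integral_eq_sub_of_hasDerivAt (fun s _ => hG s)
        (hG'.intervalIntegrable _ _), hG0]
  rw [intervalIntegral.integral_sub (hQ₁.intervalIntegrable _ _)
    (hQ₂.intervalIntegrable _ _)] at e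
  simp only [h₁.equation x 0, h₂.equation x 0, intervalIntegral.integral_same,
    intervalIntegral.integral_zero, add_zero]
  linear_combination (1 / 2) * e

/-- The Goursat solutions for the potentials `G² + G'` and `G² - G'` satisfy a first-order system:
with `P = H₁ + H₂` and `N = H₁ - H₂` it reads `∂P/∂u = G(u + v) N`, `∂N/∂v = G(u + v) P`. -/
theorem goursat_darboux_system {a : ℝ} {G G' Q₁ Q₂ : ℝ → ℂ} {H₁ H₂ : ℝ → ℝ → ℂ} {h : ℂ}
    (hG : ∀ x, HasDerivAt G (G' x) x) (hG' : Continuous G') (hG0 : G 0 = h)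
    (hQ₁ : Continuous Q₁) (hQ₂ : Continuous Q₂)
    (hQ₁G : ∀ x ∈ Set.Icc (-a) a, Q₁ x = G x ^ 2 + G' x)
    (hQ₂G : ∀ x ∈ Set.Icc (-a) a, Q₂ x = G x ^ 2 - G' x)
    (h₁ : IsGoursatIntegralSolution Q₁ h H₁) (h₂ : IsGoursatIntegralSolution Q₂ (-h) H₂)
    {u v : ℝ} (huv : |u| + |v| ≤ a) :
    goursatDu Q₁ H₁ u v + goursatDu Q₂ H₂ u v = G (u + v) * (H₁ u v - H₂ u v) ∧
      goursatDv Q₁ H₁ u v - goursatDv Q₂ H₂ u v = G (u + v) * (H₁ u v + H₂ u v) := by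
  have hGc : Continuous G := continuous_iff_continuousAt.2 fun x => (hG x).continuousAt
  have hGs : Continuous fun p : ℝ × ℝ => G (p.1 + p.2) := hGc.comp (by fun_prop)
  -- the defects of the two equations
  let R : ℝ → ℝ → ℂ := fun u v =>
    goursatDu Q₁ H₁ u v + goursatDu Q₂ H₂ u v - G (u + v) * (H₁ u v - H₂ u v)
  let S : ℝ → ℝ → ℂ := fun u v =>
    goursatDv Q₁ H₁ u v - goursatDv Q₂ H₂ u v - G (u + v) * (H₁ u v + H₂ u v)
  have hR : Continuous fun p : ℝ × ℝ => R p.1 p.2 :=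
    ((h₁.continuous_goursatDu hQ₁).add (h₂.continuous_goursatDu hQ₂)).sub
      (hGs.mul (h₁.continuous.sub h₂.continuous))
  have hS : Continuous fun p : ℝ × ℝ => S p.1 p.2 :=
    ((h₁.continuous_goursatDv hQ₁).sub (h₂.continuous_goursatDv hQ₂)).sub
      (hGs.mul (h₁.continuous.add h₂.continuous))
  have hmem : ∀ {x y : ℝ}, |x| + |y| ≤ a → x + y ∈ Set.Icc (-a) a := fun hxy =>
    abs_le.1 ((abs_add_le _ _).trans hxy)
  have hRv : ∀ x y, |x| + |y| ≤ a → HasDerivAt (fun y => R x y) (-(G (x + y) * S x y)) y := by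
    intro x y hxy
    have e := (((h₁.hasDerivAt_goursatDu hQ₁ x y).add (h₂.hasDerivAt_goursatDu hQ₂ x y)).sub
      (((hG (x + y)).comp_const_add x y).mul
        ((h₁.hasDerivAt_v hQ₁ x y).sub (h₂.hasDerivAt_v hQ₂ x y))))
    refine e.congr_deriv ?_
    simp only [Pi.sub_apply]
    rw [hQ₁G _ (hmem hxy), hQ₂G _ (hmem hxy)]
    simp only [S]; ring
  have hSu : ∀ x y, |x| + |y| ≤ a → HasDerivAt (fun x => S x y) (-(G (x + y) * R x y)) x := by
    intro x y hxy
    have e := (((h₁.hasDerivAt_goursatDv hQ₁ x y).sub (h₂.hasDerivAt_goursatDv hQ₂ x y)).sub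
      (((hG (x + y)).comp_add_const x y).mul
        ((h₁.hasDerivAt_u hQ₁ x y).add (h₂.hasDerivAt_u hQ₂ x y))))
    refine e.congr_deriv ?_
    simp only [Pi.add_apply]
    rw [hQ₁G _ (hmem hxy), hQ₂G _ (hmem hxy)]
    simp only [R]; ring
  have hR0 : ∀ x, |x| ≤ a → R x 0 = 0 := by
    intro x hx
    have hx' : x ∈ Set.Icc (-a) a := abs_le.1 hx
    have e := goursat_darboux_diagonal hG hG' hG0 hQ₁ hQ₂ hQ₁G hQ₂G h₁ h₂ x hx
    simp only [R, goursatDu, intervalIntegral.integral_same, add_zero, hQ₁G x hx', hQ₂G x hx', e]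
    ring
  have hS0 : ∀ y, S 0 y = 0 := by
    intro y
    simp [S, goursatDv, h₁.eq_zero_left, h₂.eq_zero_left, neg_div]
  have hRS := eq_zero_of_characteristic_system (a := a) hGc hR hS (fun x y hxy => ?_)
    (fun x y hxy => ?_) huv
  · exact ⟨sub_eq_zero.1 hRS.1, sub_eq_zero.1 hRS.2⟩
  · have e := intervalIntegral.integral_eq_sub_of_hasDerivAt (a := 0) (b := y)
      (fun β hβ => hRv x β (by linarith [abs_le_abs_of_mem_uIcc_zero hβ]))
      (Continuous.intervalIntegrable (((hGc.comp (by fun_prop : Continuous fun β : ℝ => x + β)).mul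
        (hS.comp (by fun_prop : Continuous fun β : ℝ => (x, β)))).neg) _ _)
    rw [hR0 x (by linarith [abs_nonneg y]), sub_zero, intervalIntegral.integral_neg] at e
    exact e.symm
  · have e := intervalIntegral.integral_eq_sub_of_hasDerivAt (a := 0) (b := x)
      (fun α hα => hSu α y (by linarith [abs_le_abs_of_mem_uIcc_zero hα]))
      (Continuous.intervalIntegrable (((hGc.comp (by fun_prop : Continuous fun α : ℝ => α + y)).mul
        (hR.comp (by fun_prop : Continuous fun α : ℝ => (α, y)))).neg) _ _)
    rw [hS0 y, sub_zero, intervalIntegral.integral_neg] at e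
    exact e.symm

/-! ### Kernels in the variables `x` and `t` -/

theorem continuous_slice {φ : ℝ × ℝ → ℂ} (hφ : Continuous φ) (y : ℝ) :
    Continuous fun t => φ (y, t) :=
  hφ.comp (by fun_prop : Continuous fun t : ℝ => (y, t))

theorem integral_neg_self_eq_sub {φ : ℝ → ℂ} (hφ : Continuous φ) (y : ℝ) :
    (∫ t in (-y)..y, φ t) = (∫ t in (0 : ℝ)..y, φ t) - ∫ t in (0 : ℝ)..(-y), φ t :=
  (intervalIntegral.integral_interval_sub_left
    (hφ.intervalIntegrable _ _) (hφ.intervalIntegrable _ _)).symm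

/-- The function `H` of the characteristic coordinates `u = (x + t) / 2`, `v = (x - t) / 2` as a
function of `x` and `t`. -/
noncomputable def ofCharacteristic (H : ℝ → ℝ → ℂ) (x t : ℝ) : ℂ := H ((x + t) / 2) ((x - t) / 2)

theorem continuous_ofCharacteristic {H : ℝ → ℝ → ℂ} (hH : Continuous fun p : ℝ × ℝ => H p.1 p.2) :
    Continuous fun p : ℝ × ℝ => ofCharacteristic H p.1 p.2 :=
  hH.comp (by fun_prop : Continuous fun p : ℝ × ℝ => ((p.1 + p.2) / 2, (p.1 - p.2) / 2))

/-- The derivative in `x` of `ofCharacteristic H`, for a Goursat solution `H`. -/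
noncomputable def goursatDx (Q : ℝ → ℂ) (H : ℝ → ℝ → ℂ) (x t : ℝ) : ℂ :=
  (ofCharacteristic (goursatDu Q H) x t + ofCharacteristic (goursatDv Q H) x t) / 2

/-- The derivative in `t` of `ofCharacteristic H`, for a Goursat solution `H`. -/
noncomputable def goursatDt (Q : ℝ → ℂ) (H : ℝ → ℝ → ℂ) (x t : ℝ) : ℂ :=
  (ofCharacteristic (goursatDu Q H) x t - ofCharacteristic (goursatDv Q H) x t) / 2

namespace IsGoursatIntegralSolution

variable {Q : ℝ → ℂ} {η : ℂ} {H : ℝ → ℝ → ℂ}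

theorem hasDerivAt_x (h : IsGoursatIntegralSolution Q η H) (hQ : Continuous Q) (x t : ℝ) :
    HasDerivAt (fun x => ofCharacteristic H x t) (goursatDx Q H x t) x := by
  have e := hasDerivAt_comp_of_partial (h.hasDerivAt_u hQ) (h.hasDerivAt_v hQ)
    (h.continuous_goursatDu hQ) (h.continuous_goursatDv hQ)
    (((hasDerivAt_id x).add_const t).div_const 2) (((hasDerivAt_id x).sub_const t).div_const 2)
  refine e.congr_deriv ?_
  simp only [goursatDx, ofCharacteristic, id]
  push_cast; ring

theorem hasDerivAt_t (h : IsGoursatIntegralSolution Q η H) (hQ : Continuous Q) (x t : ℝ) :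
    HasDerivAt (fun t => ofCharacteristic H x t) (goursatDt Q H x t) t := by
  have e := hasDerivAt_comp_of_partial (h.hasDerivAt_u hQ) (h.hasDerivAt_v hQ)
    (h.continuous_goursatDu hQ) (h.continuous_goursatDv hQ)
    (((hasDerivAt_id t).const_add x).div_const 2) (((hasDerivAt_id t).const_sub x).div_const 2)
  refine e.congr_deriv ?_
  simp only [goursatDt, ofCharacteristic, id]
  push_cast; ring

theorem continuous_goursatDx (h : IsGoursatIntegralSolution Q η H) (hQ : Continuous Q) :
    Continuous fun p : ℝ × ℝ => goursatDx Q H p.1 p.2 :=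
  ((continuous_ofCharacteristic (h.continuous_goursatDu hQ)).add
    (continuous_ofCharacteristic (h.continuous_goursatDv hQ))).div_const 2

theorem continuous_goursatDt (h : IsGoursatIntegralSolution Q η H) (hQ : Continuous Q) :
    Continuous fun p : ℝ × ℝ => goursatDt Q H p.1 p.2 :=
  ((continuous_ofCharacteristic (h.continuous_goursatDu hQ)).sub
    (continuous_ofCharacteristic (h.continuous_goursatDv hQ))).div_const 2

theorem contDiff_ofCharacteristic (h : IsGoursatIntegralSolution Q η H) (hQ : Continuous Q) :
    ContDiff ℝ 1 fun p : ℝ × ℝ => ofCharacteristic H p.1 p.2 :=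
  contDiff_one_of_partial (h.hasDerivAt_x hQ) (h.hasDerivAt_t hQ) (h.continuous_goursatDx hQ)
    (h.continuous_goursatDt hQ)

end IsGoursatIntegralSolution

/-! ### The kernel formula and the Volterra representation -/

/-- A pair of Goursat solutions linked by the Darboux transform with generating function `F` and
logarithmic derivative `G = F' / F`: on `[-a, a]` the functions `Q₁`, `Q₂` play the role of
`G² + G'`, `G² - G'`, and this enters only through its consequences `system` and `diagonal`. -/
structure DarbouxPair (a : ℝ) (G F Q₁ Q₂ : ℝ → ℂ) (H₁ H₂ : ℝ → ℝ → ℂ) : Prop where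
  hasDerivAt_F : ∀ x ∈ Set.Icc (-a) a, HasDerivAt F (G x * F x) x
  continuous_Q₁ : Continuous Q₁
  continuous_Q₂ : Continuous Q₂
  continuous_F : Continuous F
  sol₁ : IsGoursatIntegralSolution Q₁ (G 0) H₁
  sol₂ : IsGoursatIntegralSolution Q₂ (-G 0) H₂
  system : ∀ u v, |u| + |v| ≤ a →
    goursatDu Q₁ H₁ u v + goursatDu Q₂ H₂ u v = G (u + v) * (H₁ u v - H₂ u v) ∧
      goursatDv Q₁ H₁ u v - goursatDv Q₂ H₂ u v = G (u + v) * (H₁ u v + H₂ u v)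
  diagonal : ∀ x, |x| ≤ a → H₁ x 0 - H₂ x 0 = G x

namespace DarbouxPair

variable {a : ℝ} {G F Q₁ Q₂ : ℝ → ℂ} {H₁ H₂ : ℝ → ℝ → ℂ}

/-- The combination of the two first-order equations that contains only `∂_x K₂`, `K₂`, `∂_t K₁`. -/
theorem goursatDx_add (h : DarbouxPair a G F Q₁ Q₂ H₁ H₂) {x t : ℝ} (hx : x ∈ Set.Icc (-a) a)
    (ht : t ∈ Set.Icc (-a) a) :
    goursatDx Q₂ H₂ x t + G x * ofCharacteristic H₂ x t = -goursatDt Q₁ H₁ x t := by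
  have := h.system _ _ (abs_half_add_abs_half_le hx ht)
  rw [show (x + t) / 2 + (x - t) / 2 = x by ring] at this
  simp only [goursatDx, goursatDt, ofCharacteristic]
  linear_combination (1 / 2) * this.1 - (1 / 2) * this.2

/-- The kernel formula: `∂_x (F K₂) = -F ∂_t K₁`, integrated from `-t`, where
`K₂(-t, t) = -G(0) / 2`. -/
theorem mul_kernel_eq (h : DarbouxPair a G F Q₁ Q₂ H₁ H₂) {x t : ℝ} (hx : x ∈ Set.Icc (-a) a)
    (ht : t ∈ Set.Icc (-a) a) :
    F x * ofCharacteristic H₂ x t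
      = -((∫ s in (-t)..x, goursatDt Q₁ H₁ s t * F s) + G 0 / 2 * F (-t)) := by
  have ht' : -t ∈ Set.Icc (-a) a := ⟨by linarith [ht.2], by linarith [ht.1]⟩
  have hc : Continuous fun s => goursatDt Q₁ H₁ s t * F s :=
    ((h.sol₁.continuous_goursatDt h.continuous_Q₁).comp
      (by fun_prop : Continuous fun s : ℝ => (s, t))).mul h.continuous_F
  have e := intervalIntegral.integral_eq_sub_of_hasDerivAt (a := -t) (b := x)
    (f := fun s => F s * ofCharacteristic H₂ s t) (f' := fun s => -(goursatDt Q₁ H₁ s t * F s))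
    (fun s hs => ?_) (hc.neg.intervalIntegrable _ _)
  · have h0 : ofCharacteristic H₂ (-t) t = -(G 0 / 2) := by
      rw [ofCharacteristic, neg_add_cancel, zero_div, h.sol₂.eq_zero_left, neg_div]
    rw [intervalIntegral.integral_neg, h0] at e
    linear_combination -e
  · have hs' : s ∈ Set.Icc (-a) a := Set.OrdConnected.uIcc_subset Set.ordConnected_Icc ht' hx hs
    refine ((h.hasDerivAt_F s hs').mul (h.sol₂.hasDerivAt_x h.continuous_Q₂ s t)).congr_deriv ?_
    linear_combination F s * h.goursatDx_add hs' ht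

/-- Differentiating `F` times the Volterra operator with kernel `K₂` gives `F` times the
Volterra operator with kernel `K₁` applied to the derivative. -/
theorem hasDerivAt_mul_volterraOp (h : DarbouxPair a G F Q₁ Q₂ H₁ H₂) {U U' : ℝ → ℂ}
    (hU : ∀ x, HasDerivAt U (U' x) x) (hU' : Continuous U') {x : ℝ} (hx : x ∈ Set.Icc (-a) a) :
    HasDerivAt (fun x => F x * volterraOp (ofCharacteristic H₂) U x)
      (F x * volterraOp (ofCharacteristic H₁) U' x) x := by
  have hUc : Continuous U := continuous_iff_continuousAt.2 fun x => (hU x).continuousAt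
  have hUs : Continuous fun p : ℝ × ℝ => U p.2 := hUc.comp continuous_snd
  have hk : ∀ y t, HasDerivAt (fun y => ofCharacteristic H₂ y t * U t)
      (goursatDx Q₂ H₂ y t * U t) y := fun y t =>
    (h.sol₂.hasDerivAt_x h.continuous_Q₂ y t).mul_const _
  have hkc : Continuous fun p : ℝ × ℝ => ofCharacteristic H₂ p.1 p.2 * U p.2 :=
    (continuous_ofCharacteristic h.sol₂.continuous).mul hUs
  have hkc' : Continuous fun p : ℝ × ℝ => goursatDx Q₂ H₂ p.1 p.2 * U p.2 :=
    (h.sol₂.continuous_goursatDx h.continuous_Q₂).mul hUs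
  have sK₂ : ∀ y, Continuous fun t => ofCharacteristic H₂ y t * U t := continuous_slice hkc
  have sDx : ∀ y, Continuous fun t => goursatDx Q₂ H₂ y t * U t := continuous_slice hkc'
  have hV : HasDerivAt (volterraOp (ofCharacteristic H₂) U)
      (U' x + ((∫ t in (-x)..x, goursatDx Q₂ H₂ x t * U t)
        + ofCharacteristic H₂ x x * U x + ofCharacteristic H₂ x (-x) * U (-x))) x := by
    have e1 := hasDerivAt_integral_param hk hkc hkc' (hasDerivAt_id x)
    have e2 := hasDerivAt_integral_param hk hkc hkc' (hasDerivAt_neg x)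
    have e3 := (hU x).add (e1.sub e2)
    have e4 : (fun y => U y + ((∫ t in (0 : ℝ)..id y, ofCharacteristic H₂ y t * U t)
        - ∫ t in (0 : ℝ)..(-y), ofCharacteristic H₂ y t * U t))
        = volterraOp (ofCharacteristic H₂) U := by
      ext y; simp only [volterraOp, integral_neg_self_eq_sub (sK₂ y), id]
    change HasDerivAt (fun y => U y + ((∫ t in (0 : ℝ)..id y, ofCharacteristic H₂ y t * U t)
        - ∫ t in (0 : ℝ)..(-y), ofCharacteristic H₂ y t * U t)) _ x at e3
    rw [e4] at e3
    refine e3.congr_deriv ?_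
    rw [integral_neg_self_eq_sub (sDx x)]
    simp only [id]
    push_cast; ring
  refine ((h.hasDerivAt_F x hx).mul hV).congr_deriv ?_
  have sDt : ∀ y, Continuous fun t => goursatDt Q₁ H₁ y t * U t :=
    continuous_slice ((h.sol₁.continuous_goursatDt h.continuous_Q₁).mul hUs)
  have sK₁ : ∀ y, Continuous fun t => ofCharacteristic H₁ y t * U' t :=
    continuous_slice ((continuous_ofCharacteristic h.sol₁.continuous).mul
      (hU'.comp continuous_snd))
  -- integration by parts in `t`
  have parts : (∫ t in (-x)..x, goursatDt Q₁ H₁ x t * U t)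
      + (∫ t in (-x)..x, ofCharacteristic H₁ x t * U' t)
      = ofCharacteristic H₁ x x * U x - ofCharacteristic H₁ x (-x) * U (-x) := by
    rw [← intervalIntegral.integral_add ((sDt x).intervalIntegrable _ _)
      ((sK₁ x).intervalIntegrable _ _)]
    exact intervalIntegral.integral_eq_sub_of_hasDerivAt
      (f := fun t => ofCharacteristic H₁ x t * U t)
      (fun t _ => (h.sol₁.hasDerivAt_t h.continuous_Q₁ x t).mul (hU t))
      (((sDt x).add (sK₁ x)).intervalIntegrable _ _)
  have hx' : -x ∈ Set.Icc (-a) a := ⟨by linarith [hx.2], by linarith [hx.1]⟩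
  have hker : (∫ t in (-x)..x, goursatDx Q₂ H₂ x t * U t)
      + G x * (∫ t in (-x)..x, ofCharacteristic H₂ x t * U t)
      = -∫ t in (-x)..x, goursatDt Q₁ H₁ x t * U t := by
    rw [← intervalIntegral.integral_const_mul, ← intervalIntegral.integral_add
      ((sDx x).intervalIntegrable _ _) (((sK₂ x).intervalIntegrable _ _).const_mul _),
      ← intervalIntegral.integral_neg]
    refine intervalIntegral.integral_congr fun t ht => ?_
    have ht' : t ∈ Set.Icc (-a) a := Set.OrdConnected.uIcc_subset Set.ordConnected_Icc hx' hx ht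
    linear_combination U t * h.goursatDx_add hx ht'
  have d1 : ofCharacteristic H₁ x x - ofCharacteristic H₂ x x = G x := by
    simpa [ofCharacteristic] using h.diagonal x (abs_le.2 hx)
  have d2 : ofCharacteristic H₁ x (-x) + ofCharacteristic H₂ x (-x) = 0 := by
    simp only [ofCharacteristic, add_neg_cancel, zero_div, h.sol₁.eq_zero_left,
      h.sol₂.eq_zero_left]
    ring
  simp only [volterraOp]
  linear_combination F x * hker - F x * parts - F x * U x * d1 + F x * U (-x) * d2

theorem mul_volterraOp_eq (h : DarbouxPair a G F Q₁ Q₂ H₁ H₂) {U U' : ℝ → ℂ}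
    (hU : ∀ x, HasDerivAt U (U' x) x) (hU' : Continuous U') {x : ℝ} (hx : x ∈ Set.Icc (-a) a) :
    F x * volterraOp (ofCharacteristic H₂) U x
      = (∫ s in (0 : ℝ)..x, F s * volterraOp (ofCharacteristic H₁) U' s) + F 0 * U 0 := by
  have hc : Continuous (volterraOp (ofCharacteristic H₁) U') := by
    have hk : Continuous fun p : ℝ × ℝ => ofCharacteristic H₁ p.1 p.2 * U' p.2 :=
      (continuous_ofCharacteristic h.sol₁.continuous).mul (hU'.comp continuous_snd)
    have hi := fun (b : ℝ → ℝ) (hb : Continuous b) =>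
      intervalIntegral.continuous_parametric_intervalIntegral_of_continuous (a₀ := 0)
        (μ := MeasureTheory.volume)
        (f := fun y t => ofCharacteristic H₁ y t * U' t) hk hb
    have : volterraOp (ofCharacteristic H₁) U' = fun y => U' y +
        ((∫ t in (0 : ℝ)..y, ofCharacteristic H₁ y t * U' t)
          - ∫ t in (0 : ℝ)..(-y), ofCharacteristic H₁ y t * U' t) := by
      ext y
      have hs : Continuous fun t => ofCharacteristic H₁ y t * U' t := continuous_slice hk y
      rw [volterraOp, integral_neg_self_eq_sub hs]
    rw [this]
    exact hU'.add ((hi _ continuous_id).sub (hi _ continuous_neg))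
  have h0 : (0 : ℝ) ∈ Set.Icc (-a) a := by
    have h1 := hx.1; have h2 := hx.2
    constructor <;> linarith
  have e := intervalIntegral.integral_eq_sub_of_hasDerivAt (a := 0) (b := x)
    (fun s hs => h.hasDerivAt_mul_volterraOp hU hU'
      (Set.OrdConnected.uIcc_subset Set.ordConnected_Icc h0 hx hs))
    ((h.continuous_F.mul hc).intervalIntegrable _ _)
  have h1 : volterraOp (ofCharacteristic H₂) U 0 = U 0 := by simp [volterraOp]
  rw [e, h1]; ring

end DarbouxPair

/-! ### The transmutation operator of the Darboux transformed potential -/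

theorem volterraOp_congr {a x : ℝ} {k k' : ℝ → ℝ → ℂ} {u u' : ℝ → ℂ} (hx : x ∈ Set.Icc (-a) a)
    (hk : ∀ t ∈ Set.Icc (-a) a, k x t = k' x t) (hu : ∀ t ∈ Set.Icc (-a) a, u t = u' t) :
    volterraOp k u x = volterraOp k' u' x := by
  have hx' : -x ∈ Set.Icc (-a) a := ⟨by linarith [hx.2], by linarith [hx.1]⟩
  rw [volterraOp, volterraOp, hu x hx]
  congr 1
  refine intervalIntegral.integral_congr fun t ht => ?_
  have ht' : t ∈ Set.Icc (-a) a := Set.OrdConnected.uIcc_subset Set.ordConnected_Icc hx' hx ht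
  simp only [hk t ht', hu t ht']

/-- The Riccati equation for the logarithmic derivative of a solution of `f'' = q f`. -/
theorem derivWithin_logDeriv {a : ℝ} (ha : 0 < a) {q f : ℝ → ℂ}
    (hf : ContDiffOn ℝ 2 f (Set.Icc (-a) a))
    (hAf : ∀ x ∈ Set.Icc (-a) a, schrodingerOp a q f x = 0)
    (hf_ne : ∀ x ∈ Set.Icc (-a) a, f x ≠ 0) :
    ContDiffOn ℝ 1 (fun x => derivWithin f (Set.Icc (-a) a) x / f x) (Set.Icc (-a) a) ∧
      ∀ x ∈ Set.Icc (-a) a,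
        derivWithin (fun x => derivWithin f (Set.Icc (-a) a) x / f x) (Set.Icc (-a) a) x
          = q x - (derivWithin f (Set.Icc (-a) a) x / f x) ^ 2 := by
  have hud : UniqueDiffOn ℝ (Set.Icc (-a) a) := uniqueDiffOn_Icc (by linarith)
  have hf1 : ContDiffOn ℝ 1 f (Set.Icc (-a) a) := hf.of_le (by norm_num)
  have hf' : ContDiffOn ℝ 1 (derivWithin f (Set.Icc (-a) a)) (Set.Icc (-a) a) :=
    hf.derivWithin hud (by norm_num)
  refine ⟨by
    simp only [div_eq_mul_inv]
    exact hf'.mul (hf1.inv hf_ne), fun x hx => ?_⟩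
  have e1 := (hf1.differentiableOn one_ne_zero x hx).hasDerivWithinAt
  have e2 := (hf'.differentiableOn one_ne_zero x hx).hasDerivWithinAt
  have e3 := (e2.div e1 (hf_ne x hx)).derivWithin (hud x hx)
  have e4 := hAf x hx
  rw [schrodingerOp, sub_eq_zero] at e4
  refine e3.trans ?_
  rw [e4]
  have := hf_ne x hx
  field_simp

theorem mainTheorem1 (a : ℝ) (ha : 0 < a) (q₁ f : ℝ → ℂ) (h : ℂ)
    (hq₁ : ContinuousOn q₁ (Set.Icc (-a) a))
    (hf : ContDiffOn ℝ 2 f (Set.Icc (-a) a))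
    (hAf : ∀ x ∈ Set.Icc (-a) a, schrodingerOp a q₁ f x = 0)
    (hf_ne : ∀ x ∈ Set.Icc (-a) a, f x ≠ 0)
    (hf_zero : f 0 = 1)
    (hf'_zero : derivWithin f (Set.Icc (-a) a) 0 = h) :
    -- both kernels are continuously differentiable on the square, so that all derivatives and
    -- integrals below exist
    ContDiffOn ℝ 1 (fun p : ℝ × ℝ => transmutationKernel a q₁ h p.1 p.2)
      (Set.Icc (-a) a ×ˢ Set.Icc (-a) a) ∧
    ContDiffOn ℝ 1
      (fun p : ℝ × ℝ => transmutationKernel a (darbouxPotential a q₁ f) (-h) p.1 p.2)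
      (Set.Icc (-a) a ×ˢ Set.Icc (-a) a) ∧
    -- the kernel of the transmutation operator for the Darboux transformed potential
    (∀ x ∈ Set.Icc (-a) a, ∀ t ∈ Set.Icc (-a) a,
      transmutationKernel a (darbouxPotential a q₁ f) (-h) x t = darbouxKernel a q₁ f h x t) ∧
    -- the Volterra representation of `T₂`, and its coincidence with the transmutation operator
    (∀ u : ℝ → ℂ, ContDiffOn ℝ 1 u (Set.Icc (-a) a) → ∀ x ∈ Set.Icc (-a) a,
      darbouxTransmutation a q₁ f h u x = volterraOp (darbouxKernel a q₁ f h) u x ∧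
      darbouxTransmutation a q₁ f h u x
        = transmutationOp a (darbouxPotential a q₁ f) (-h) u x) ∧
    -- the coincidence on continuous functions
    (∀ u : ℝ → ℂ, ContinuousOn u (Set.Icc (-a) a) → ∀ x ∈ Set.Icc (-a) a,
      transmutationOp a (darbouxPotential a q₁ f) (-h) u x
        = volterraOp (darbouxKernel a q₁ f h) u x) := by
  have hud : UniqueDiffOn ℝ (Set.Icc (-a) a) := uniqueDiffOn_Icc (by linarith)
  have h0 : (0 : ℝ) ∈ Set.Icc (-a) a := ⟨by linarith, ha.le⟩
  have hf1 : ContDiffOn ℝ 1 f (Set.Icc (-a) a) := hf.of_le (by norm_num)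
  obtain ⟨hg, hg'⟩ := derivWithin_logDeriv ha hf hAf hf_ne
  obtain ⟨G, G', hG'c, hGd, hGg, hG'g⟩ := exists_hasDerivAt_extension ha hg
  obtain ⟨F, F', hF'c, hFd, hFf, hF'f⟩ := exists_hasDerivAt_extension ha hf1
  have hq₂ : ContinuousOn (darbouxPotential a q₁ f) (Set.Icc (-a) a) :=
    (continuousOn_const.mul (hg.continuousOn.pow 2)).sub hq₁
  obtain ⟨Q₁, H₁, hQ₁, hQ₁q, hH₁, hK₁⟩ := exists_transmutationKernel_eq ha.le hq₁ h
  obtain ⟨Q₂, H₂, hQ₂, hQ₂q, hH₂, hK₂⟩ := exists_transmutationKernel_eq ha.le hq₂ (-h)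
  have hG0 : G 0 = h := by rw [hGg 0 h0, hf_zero, hf'_zero, div_one]
  have hQ₁G : ∀ x ∈ Set.Icc (-a) a, Q₁ x = G x ^ 2 + G' x := fun x hx => by
    rw [hQ₁q x hx, hGg x hx, hG'g x hx, hg' x hx]; ring
  have hQ₂G : ∀ x ∈ Set.Icc (-a) a, Q₂ x = G x ^ 2 - G' x := fun x hx => by
    rw [hQ₂q x hx, hGg x hx, hG'g x hx, hg' x hx, darbouxPotential]; ring
  have pair : DarbouxPair a G F Q₁ Q₂ H₁ H₂ :=
    { hasDerivAt_F := fun x hx => (hFd x).congr_deriv (by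
        rw [hF'f x hx, hGg x hx, hFf x hx, div_mul_cancel₀ _ (hf_ne x hx)])
      continuous_Q₁ := hQ₁
      continuous_Q₂ := hQ₂
      continuous_F := continuous_iff_continuousAt.2 fun x => (hFd x).continuousAt
      sol₁ := hG0 ▸ hH₁
      sol₂ := hG0 ▸ hH₂
      system := fun u v huv =>
        goursat_darboux_system hGd hG'c hG0 hQ₁ hQ₂ hQ₁G hQ₂G hH₁ hH₂ huv
      diagonal := goursat_darboux_diagonal hGd hG'c hG0 hQ₁ hQ₂ hQ₁G hQ₂G hH₁ hH₂ }
  have hkernel : ∀ x ∈ Set.Icc (-a) a, ∀ t ∈ Set.Icc (-a) a,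
      transmutationKernel a (darbouxPotential a q₁ f) (-h) x t = darbouxKernel a q₁ f h x t := by
    intro x hx t ht
    have ht' : -t ∈ Set.Icc (-a) a := ⟨by linarith [ht.2], by linarith [ht.1]⟩
    have e1 : (∫ s in (-t)..x, derivWithin (fun t' : ℝ => transmutationKernel a q₁ h s t')
        (Set.Icc (-a) a) t * f s) = ∫ s in (-t)..x, goursatDt Q₁ H₁ s t * F s := by
      refine intervalIntegral.integral_congr fun s hs => ?_
      have hs' : s ∈ Set.Icc (-a) a := Set.OrdConnected.uIcc_subset Set.ordConnected_Icc ht' hx hs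
      have e2 : derivWithin (fun t' : ℝ => transmutationKernel a q₁ h s t') (Set.Icc (-a) a) t
          = goursatDt Q₁ H₁ s t :=
        ((hH₁.hasDerivAt_t hQ₁ s t).hasDerivWithinAt.congr (fun t' ht' => hK₁ s hs' t' ht')
          (hK₁ s hs' t ht)).derivWithin (hud t ht)
      simp only [e2, hFf s hs']
    have e3 := pair.mul_kernel_eq hx ht
    rw [hG0, hFf x hx, hFf _ ht'] at e3
    have e4 : transmutationKernel a (darbouxPotential a q₁ f) (-h) x t
      = ofCharacteristic H₂ x t := hK₂ x hx t ht
    have := hf_ne x hx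
    rw [darbouxKernel, e1, e4]
    field_simp
    linear_combination 2 * e3
  have hvol : ∀ u : ℝ → ℂ, ∀ x ∈ Set.Icc (-a) a,
      transmutationOp a (darbouxPotential a q₁ f) (-h) u x
        = volterraOp (darbouxKernel a q₁ f h) u x := fun u x hx =>
    volterraOp_congr hx (hkernel x hx) fun _ _ => rfl
  refine ⟨(hH₁.contDiff_ofCharacteristic hQ₁).contDiffOn.congr fun p hp => hK₁ _ hp.1 _ hp.2,
    (hH₂.contDiff_ofCharacteristic hQ₂).contDiffOn.congr fun p hp => hK₂ _ hp.1 _ hp.2,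
    hkernel, fun u hu x hx => ?_, fun u _ => hvol u⟩
  have key : darbouxTransmutation a q₁ f h u x
      = transmutationOp a (darbouxPotential a q₁ f) (-h) u x := by
    obtain ⟨U, U', hU'c, hUd, hUu, hU'u⟩ := exists_hasDerivAt_extension ha hu
    have e1 := pair.mul_volterraOp_eq hUd hU'c hx
    have e2 : transmutationOp a (darbouxPotential a q₁ f) (-h) u x
        = volterraOp (ofCharacteristic H₂) U x :=
      volterraOp_congr hx (hK₂ x hx) fun t ht => (hUu t ht).symm
    have e3 : (∫ s in (0 : ℝ)..x, f s *
        transmutationOp a q₁ h (derivWithin u (Set.Icc (-a) a)) s)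
        = ∫ s in (0 : ℝ)..x, F s * volterraOp (ofCharacteristic H₁) U' s := by
      refine intervalIntegral.integral_congr fun s hs => ?_
      have hs' : s ∈ Set.Icc (-a) a := Set.OrdConnected.uIcc_subset Set.ordConnected_Icc h0 hx hs
      have e4 : transmutationOp a q₁ h (derivWithin u (Set.Icc (-a) a)) s
          = volterraOp (ofCharacteristic H₁) U' s :=
        volterraOp_congr hs' (hK₁ s hs') fun t ht => (hU'u t ht).symm
      simp only [e4, hFf s hs']
    rw [hFf x hx, hFf 0 h0, hUu 0 h0, hf_zero, one_mul] at e1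
    have := hf_ne x hx
    rw [darbouxTransmutation, e2, e3, ← e1]
    field_simp
  exact ⟨key.trans (hvol u x hx), key⟩
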